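/- Let $\mathbb F$ be a field. A symplectic alternating algebra (SAA) over $\mathbb F$ is a symplectic vector space $L$ over $\mathbb F$, with non-degenerate alternating form $(\cdot,\cdot)$, together with an alternating bilinear product $L\times L\to L$ such that $(xy,z)=(yz,x)$ for all $x,y,z\in L$. Isomorphisms of SAAs are linear bijections preserving both the form and the product. For subspaces $A,B$ of $L$ let $AB$ be the linear span of all products $ab$ with $a\in A$, $b\in B$; put $L^1=L$ and $L^{k+1}=L^kL$, and call $L$ nilpotent of class $c$ if $c$ is the least integer with $L^{c+1}=0$. The centre is $Z(L)=\{x\in L : xy=0 \text{ for all } y\in L\}$, and a subspace is isotropic if the form vanishes identically on it. A standard basis of a $10$-dimensional SAA is a basis $x_1,\dots,x_5,y_1,\dots,y_5$ with $(x_i,x_j)=(y_i,y_j)=0$ and $(x_i,y_j)=\delta_{ij}$. Let $I_1=L^5L^2$, $I_2=L^7$, $I_3=L^6$ and put $U=\{x\in L^4 : xL^3\le I_k\}$, where $k$ is the smallest index with $I_k\cap L^4L^3\ne 0$ (for definiteness $k=3$ if there is none). Let $\mathcal F$ be the class of nilpotent SAAs $L$ over $\mathbb F$ of dimension $10$ with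 isotropic centre of dimension $2$ that are of class $7$ and satisfy $L^4L^3\neq L^7$, $L^5L^2\le L^4L^3$ and $\dim UL^2=1$. For $r\in\mathbb F^*$ say that an SAA has the presentation $\mathcal P_{10}^{(2,5)}(r)$ if it has a standard basis with $$(x_2y_3,y_5)=r,\quad (x_3y_4,y_5)=1,\quad (x_1y_2,y_5)=1,\quad (y_1y_2,y_3)=1,$$ all triple values $(uv,w)$ of basis elements $u,v,w$ being zero unless they arise from these by permuting $u,v,w$ (under which $(uv,w)$ is alternating). Then: 1. Every $L$ in $\mathcal F$ has a presentation $\mathcal P_{10}^{(2,5)}(r)$ for some $r\neq 0$. 2. Conversely, every SAA with a presentation $\mathcal P_{10}^{(2,5)}(r)$, $r\ne0$, lies in $\mathcal F$, and for every $r\neq0$ there is an SAA with this presentation. 3. For $r,s\ne 0$, the presentations $\mathcal P_{10}^{(2,5)}(r)$ and $\mathcal P_{10}^{(2,5)}(s)$ describe the same algebra (that is, an SAA with the first presentation and an SAA with the second are isomorphic) if and only if $s/r\in(\mathbb F^*)^3$. -/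

import Mathlib

/-- A symplectic alternating algebra structure on an `F`-vector space `L`: a non-degenerate
alternating form `(u, v) = form u v` together with an alternating bilinear product
`u · v = mul u v` such that `(x · y, z) = (y · z, x)`. -/
structure SAA (F L : Type*) [Field F] [AddCommGroup L] [Module F L] where
  form : LinearMap.BilinForm F L
  form_alt : form.IsAlt
  form_nondegenerate : form.Nondegenerate
  mul : L →ₗ[F] L →ₗ[F] L
  mul_alt : mul.IsAlt
  form_mul : ∀ x y z : L, form (mul x y) z = form (mul y z) x

namespace SAA

section

variable {F L M : Type*} [Field F] [AddCommGroup L] [Module F L] [AddCommGroup M] [Module F M]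

/-- The product `A B` of two subspaces: the linear span of all `a · b`, `a ∈ A`, `b ∈ B`. -/
def prod (S : SAA F L) (A B : Submodule F L) : Submodule F L :=
  Submodule.map₂ S.mul A B

/-- The powers `L ^ 1 = L`, `L ^ (k + 1) = L ^ k L`
(the index `0` is not used; the value there is `L`). -/
def power (S : SAA F L) : ℕ → Submodule F L
  | 0 => ⊤
  | 1 => ⊤
  | k + 2 => S.prod (S.power (k + 1)) ⊤

/-- `L` is nilpotent of class `c`: `c` is the least `k` with `L ^ (k + 1) = 0`. -/
def IsNilpotentOfClass (S : SAA F L) (c : ℕ) : Prop :=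
  IsLeast {k : ℕ | S.power (k + 1) = ⊥} c

/-- The centre `Z(L) = {x | x · y = 0 for all y}`. -/
def center (S : SAA F L) : Submodule F L :=
  LinearMap.ker S.mul

/-- A subspace on which the form vanishes identically. -/
def IsIsotropic (S : SAA F L) (A : Submodule F L) : Prop :=
  ∀ u ∈ A, ∀ v ∈ A, S.form u v = 0

/-- The transporter `{x ∈ A | x B ≤ C}`. -/
def transporter (S : SAA F L) (A B C : Submodule F L) : Submodule F L where
  carrier := {x | x ∈ A ∧ ∀ b ∈ B, S.mul x b ∈ C}
  zero_mem' := ⟨A.zero_mem, fun b _ => by simp⟩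
  add_mem' := fun hx hy => ⟨A.add_mem hx.1 hy.1, fun b hb => by
    simpa using C.add_mem (hx.2 b hb) (hy.2 b hb)⟩
  smul_mem' := fun c x hx => ⟨A.smul_mem c hx.1, fun b hb => by
    simpa using C.smul_mem c (hx.2 b hb)⟩

open Classical in
/-- The first of the subspaces `I₁ = L⁵L²`, `I₂ = L⁷`, `I₃ = L⁶` that meets `L⁴L³`
non-trivially (with `I₃` as the default). -/
noncomputable def firstMeeting (S : SAA F L) : Submodule F L :=
  if S.prod (S.power 5) (S.power 2) ⊓ S.prod (S.power 4) (S.power 3) ≠ ⊥ then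
    S.prod (S.power 5) (S.power 2)
  else if S.power 7 ⊓ S.prod (S.power 4) (S.power 3) ≠ ⊥ then S.power 7
  else S.power 6

/-- The ideal `U = {x ∈ L⁴ | x L³ ≤ I_k}`, where `I_k` is the first of `L⁵L²`, `L⁷`, `L⁶`
that meets `L⁴L³` non-trivially. -/
noncomputable def idealU (S : SAA F L) : Submodule F L :=
  S.transporter (S.power 4) (S.power 3) S.firstMeeting

/-- The class of algebras under consideration: dimension `10`, isotropic centre of dimension `2`,
nilpotent of class `7`, `L⁴L³ ≠ L⁷`, `L⁵L² ≤ L⁴L³` and `dim U L² = 1`. -/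
structure InFamily (S : SAA F L) : Prop where
  finrank_eq : Module.finrank F L = 10
  nilpotent : S.IsNilpotentOfClass 7
  center_isotropic : S.IsIsotropic S.center
  finrank_center : Module.finrank F S.center = 2
  prod43_ne : S.prod (S.power 4) (S.power 3) ≠ S.power 7
  prod52_le : S.prod (S.power 5) (S.power 2) ≤ S.prod (S.power 4) (S.power 3)
  finrank_U : Module.finrank F (S.prod S.idealU (S.power 2)) = 1

/-- A basis `x₁, …, xₙ, y₁, …, yₙ` (indices shifted to `0, …, n - 1`) is standard if
`(xᵢ, xⱼ) = (yᵢ, yⱼ) = 0` and `(xᵢ, yⱼ) = δᵢⱼ`. -/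
structure IsStandardBasis (S : SAA F L) {n : ℕ} (b : Module.Basis (Fin n ⊕ Fin n) F L) :
    Prop where
  xx : ∀ i j, S.form (b (.inl i)) (b (.inl j)) = 0
  yy : ∀ i j, S.form (b (.inr i)) (b (.inr j)) = 0
  xy : ∀ i j, S.form (b (.inl i)) (b (.inr j)) = if i = j then 1 else 0

/-- `S` satisfies the nilpotent presentation `(xᵢyⱼ, yₖ) = α i j k`, `(yᵢyⱼ, yₖ) = β i j k`
for `i < j < k` with respect to the standard basis `b`: all triple values that are not obtained
from the listed ones by permuting the three (alternating) arguments are zero. -/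
structure Satisfies (S : SAA F L) {n : ℕ} (b : Module.Basis (Fin n ⊕ Fin n) F L)
    (α β : Fin n → Fin n → Fin n → F) : Prop where
  standard : S.IsStandardBasis b
  xxx : ∀ i j k, S.form (S.mul (b (.inl i)) (b (.inl j))) (b (.inl k)) = 0
  xxy : ∀ i j k, S.form (S.mul (b (.inl i)) (b (.inl j))) (b (.inr k)) = 0
  xyy : ∀ i j k, j < k → S.form (S.mul (b (.inl i)) (b (.inr j))) (b (.inr k)) =
    if i < j then α i j k else 0
  yyy : ∀ i j k, i < j → j < k →
    S.form (S.mul (b (.inr i)) (b (.inr j))) (b (.inr k)) = β i j k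

/-- The values `(x₂y₃, y₅) = r`, `(x₃y₄, y₅) = 1`, `(x₁y₂, y₅) = 1` (indices shifted by one). -/
def alphaP (r : F) (i j k : Fin 5) : F :=
  if (i, j, k) = (1, 2, 4) then r
  else if (i, j, k) = (2, 3, 4) then 1
  else if (i, j, k) = (0, 1, 4) then 1
  else 0

/-- The value `(y₁y₂, y₃) = 1` (indices shifted by one). -/
def betaP (i j k : Fin 5) : F :=
  if (i, j, k) = (0, 1, 2) then 1 else 0

/-- `S` has the presentation `(x₂y₃, y₅) = r`, `(x₃y₄, y₅) = 1`, `(x₁y₂, y₅) = 1`,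
`(y₁y₂, y₃) = 1` with respect to some standard basis. -/
def HasPresentation (S : SAA F L) (r : F) : Prop :=
  ∃ b : Module.Basis (Fin 5 ⊕ Fin 5) F L, S.Satisfies b (alphaP r) betaP

/-- Two symplectic alternating algebras are isomorphic: there is a linear bijection that preserves
the form and the product. -/
def IsIsomorphic (S : SAA F L) (T : SAA F M) : Prop :=
  ∃ e : L ≃ₗ[F] M, (∀ u v, T.form (e u) (e v) = S.form u v) ∧
    ∀ u v, e (S.mul u v) = T.mul (e u) (e v)

end

end SAA

/-! The alternating trilinear form (uv, w), called `tri`, determines the product because the form is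
non-degenerate. Indices run from 0 to 4.

Existence. Moving factors across the form gives L^i ⊥ L^j for i + j = 9. Dimension counts then force
L^1, ..., L^7 to have dimensions 10, 8, 7, 6, 4, 3, 2, so that L^i and L^j are exact orthogonal
complements (`InFamily.mem_power_iff`). It follows that J = L^5L^2 is a line Fj inside L^7, and that
U lies halfway between L^5 and L^4: it is isotropic of dimension 5 with UU = 0, and dim UL^2 = 1
means UL^2 = J. Put H = j^⊥. Then (UH, H) = 0, so `tri` induces an alternating 3-form on the
four-dimensional space H/U. This 3-form is non-zero because L^4L^3 ≠ L^7, hence its radical is a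
line, which supplies y_3. A vector y_4 outside H moves U down the filtration, x_0 → x_1 → x_2 → x_3
→ 0, and annihilates x_4 = j. Such data form an `IsChain` (`InFamily.exists_isChain`). Changing y_0,
..., y_3 modulo U removes every remaining value except q = (y_0y_1, y_2), and rescaling turns q into
r = q⁻¹ (`IsChain.exists_presentation`).

Converse. In a presented algebra each power of L is spanned by the basis vectors of sufficient depth
(`power_eq_coordSpan`), so the family conditions can be read off in coordinates.

Isomorphism. The powers and U are invariants, so a change between two presenting bases is triangular
in the coefficients that matter. The diagonal coefficients then give s = r a^3
(`Satisfies.exists_cube`), and a diagonal rescaling realises every such s. -/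

namespace SAA

/-! ### The trilinear form, standard bases and presentations. -/

section generic

variable {F L M : Type*} [Field F] [AddCommGroup L] [Module F L] [AddCommGroup M] [Module F M]
variable (S : SAA F L) (T : SAA F M)

theorem form_self (u : L) : S.form u u = 0 := S.form_alt u

theorem form_swap (u v : L) : S.form u v = -S.form v u :=
  (LinearMap.BilinForm.IsAlt.neg_eq S.form_alt v u).symm

theorem mul_self (u : L) : S.mul u u = 0 := S.mul_alt u

theorem mul_swap (u v : L) : S.mul u v = -S.mul v u := (S.mul_alt.neg v u).symm

theorem eq_zero_of_form_left {u : L} (h : ∀ v, S.form u v = 0) : u = 0 :=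
  S.form_nondegenerate.1 u h

/-- The alternating trilinear form `(u v, w)`. -/
def tri (u v w : L) : F := S.form (S.mul u v) w

theorem tri_def (u v w : L) : S.tri u v w = S.form (S.mul u v) w := rfl

theorem tri_cycle (u v w : L) : S.tri u v w = S.tri v w u := S.form_mul u v w

theorem tri_swap_left (u v w : L) : S.tri u v w = -S.tri v u w := by
  simp only [tri, S.mul_swap u v, map_neg, LinearMap.neg_apply]

theorem tri_swap_right (u v w : L) : S.tri u v w = -S.tri u w v := by
  rw [tri_cycle, tri_swap_left, ← tri_cycle S u w v]

theorem tri_swap_outer (u v w : L) : S.tri u v w = -S.tri w v u := by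
  rw [tri_cycle, tri_swap_right, ← tri_cycle S w v u, neg_inj]

@[simp] theorem tri_self_left (u w : L) : S.tri u u w = 0 := by simp [tri, S.mul_self]

@[simp] theorem tri_self_right (u w : L) : S.tri u w w = 0 := by rw [tri_cycle]; simp

@[simp] theorem tri_self_outer (u w : L) : S.tri u w u = 0 := by rw [← tri_cycle]; simp

theorem tri_add_left (u u' v w : L) : S.tri (u + u') v w = S.tri u v w + S.tri u' v w := by
  simp [tri]

theorem tri_add_mid (u v v' w : L) : S.tri u (v + v') w = S.tri u v w + S.tri u v' w := by
  simp [tri]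

theorem tri_add_right (u v w w' : L) : S.tri u v (w + w') = S.tri u v w + S.tri u v w' := by
  simp [tri]

theorem tri_smul_left (c : F) (u v w : L) : S.tri (c • u) v w = c * S.tri u v w := by
  simp [tri]

theorem tri_smul_mid (c : F) (u v w : L) : S.tri u (c • v) w = c * S.tri u v w := by
  simp [tri]

theorem tri_smul_right (c : F) (u v w : L) : S.tri u v (c • w) = c * S.tri u v w := by
  simp [tri]

theorem tri_sub_left (u u' v w : L) : S.tri (u - u') v w = S.tri u v w - S.tri u' v w := by
  simp [tri]

theorem tri_sub_mid (u v v' w : L) : S.tri u (v - v') w = S.tri u v w - S.tri u v' w := by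
  simp [tri]

theorem tri_sub_right (u v w w' : L) : S.tri u v (w - w') = S.tri u v w - S.tri u v w' := by
  simp [tri]

/-- A family of vectors whose Gram matrix is that of a standard basis is linearly independent. -/
theorem linearIndependent_of_standard {n : ℕ} {x y : Fin n → L}
    (xx : ∀ i j, S.form (x i) (x j) = 0) (yy : ∀ i j, S.form (y i) (y j) = 0)
    (xy : ∀ i j, S.form (x i) (y j) = if i = j then 1 else 0) :
    LinearIndependent F (Sum.elim x y) := by
  rw [Fintype.linearIndependent_iff]
  intro g hg
  have h : (∑ i, g (.inl i) • x i) + ∑ i, g (.inr i) • y i = 0 := by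
    simpa [Fintype.sum_sum_type] using hg
  have yx : ∀ i j, S.form (y i) (x j) = if i = j then -1 else 0 := by
    intro i j
    rw [S.form_swap, xy]
    by_cases hij : i = j
    · simp [hij]
    · simp [hij, Ne.symm hij]
  rintro (j | j)
  · have := congrArg (fun v => S.form v (y j)) h
    simpa [map_sum, LinearMap.sum_apply, xy, yy] using this
  · have := congrArg (fun v => S.form v (x j)) h
    simpa [map_sum, LinearMap.sum_apply, yx, xx] using this

theorem exists_basis_of_standard {n : ℕ} (hpos : 0 < n) (hn : Module.finrank F L = n + n)
    {x y : Fin n → L}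
    (xx : ∀ i j, S.form (x i) (x j) = 0) (yy : ∀ i j, S.form (y i) (y j) = 0)
    (xy : ∀ i j, S.form (x i) (y j) = if i = j then 1 else 0) :
    ∃ b : Module.Basis (Fin n ⊕ Fin n) F L,
      (∀ i, b (.inl i) = x i) ∧ (∀ i, b (.inr i) = y i) ∧ S.IsStandardBasis b := by
  have hli := S.linearIndependent_of_standard xx yy xy
  have : Nonempty (Fin n ⊕ Fin n) := ⟨.inl ⟨0, hpos⟩⟩
  refine ⟨basisOfLinearIndependentOfCardEqFinrank hli (by simp [hn]), ?_, ?_, ?_⟩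
  · intro i; simp
  · intro i; simp
  · constructor <;> intro i j <;> simp [xx, yy, xy]

variable {S T} {n : ℕ}

theorem IsStandardBasis.yx {b : Module.Basis (Fin n ⊕ Fin n) F L} (h : S.IsStandardBasis b)
    (i j : Fin n) : S.form (b (.inr i)) (b (.inl j)) = if i = j then -1 else 0 := by
  rw [S.form_swap, h.xy]
  by_cases hij : i = j
  · simp [hij]
  · simp [hij, Ne.symm hij]

/-- Rescaling a standard basis by `x i ↦ c i • x i`, `y i ↦ (c i)⁻¹ • y i`. -/
theorem Satisfies.scale {b : Module.Basis (Fin n ⊕ Fin n) F L} {α β : Fin n → Fin n → Fin n → F}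
    (h : S.Satisfies b α β) (c : Fin n → Fˣ) :
    S.Satisfies (b.unitsSMul (Sum.elim c fun i => (c i)⁻¹))
      (fun i j k => c i * (c j : F)⁻¹ * (c k : F)⁻¹ * α i j k)
      (fun i j k => (c i : F)⁻¹ * (c j : F)⁻¹ * (c k : F)⁻¹ * β i j k) where
  standard :=
    { xx := fun i j => by simp [Module.Basis.unitsSMul_apply, Units.smul_def, h.standard.xx]
      yy := fun i j => by simp [Module.Basis.unitsSMul_apply, Units.smul_def, h.standard.yy]
      xy := fun i j => by
        by_cases hij : i = j
        · simp [Module.Basis.unitsSMul_apply, Units.smul_def, h.standard.xy, hij]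
        · simp [Module.Basis.unitsSMul_apply, Units.smul_def, h.standard.xy, hij] }
  xxx := fun i j k => by simp [Module.Basis.unitsSMul_apply, Units.smul_def, h.xxx]
  xxy := fun i j k => by simp [Module.Basis.unitsSMul_apply, Units.smul_def, h.xxy]
  xyy := fun i j k hjk => by
    simp only [Module.Basis.unitsSMul_apply, Units.smul_def, Sum.elim_inl, Sum.elim_inr, map_smul,
      LinearMap.smul_apply, h.xyy i j k hjk, smul_eq_mul, Units.val_inv_eq_inv_val]
    split_ifs <;> ring
  yyy := fun i j k hij hjk => by
    simp only [Module.Basis.unitsSMul_apply, Units.smul_def, Sum.elim_inr, map_smul,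
      LinearMap.smul_apply, h.yyy i j k hij hjk, smul_eq_mul, Units.val_inv_eq_inv_val]
    ring

theorem Satisfies.congr {b : Module.Basis (Fin n ⊕ Fin n) F L}
    {α β α' β' : Fin n → Fin n → Fin n → F} (h : S.Satisfies b α β)
    (hα : ∀ i j k, i < j → j < k → α i j k = α' i j k)
    (hβ : ∀ i j k, i < j → j < k → β i j k = β' i j k) : S.Satisfies b α' β' where
  standard := h.standard
  xxx := h.xxx
  xxy := h.xxy
  xyy := fun i j k hjk => by
    rw [h.xyy i j k hjk]
    split_ifs with hij
    · exact hα i j k hij hjk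
    · rfl
  yyy := fun i j k hij hjk => by rw [h.yyy i j k hij hjk, hβ i j k hij hjk]

/-- A presentation determines all triple values of basis elements. -/
theorem Satisfies.tri_eq {b : Module.Basis (Fin n ⊕ Fin n) F L}
    {b' : Module.Basis (Fin n ⊕ Fin n) F M} {α β : Fin n → Fin n → Fin n → F}
    (h : S.Satisfies b α β) (h' : T.Satisfies b' α β) (p q s : Fin n ⊕ Fin n) :
    S.tri (b p) (b q) (b s) = T.tri (b' p) (b' q) (b' s) := by
  have xxy : ∀ i j k, S.tri (b (.inl i)) (b (.inl j)) (b (.inr k)) =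
      T.tri (b' (.inl i)) (b' (.inl j)) (b' (.inr k)) := fun i j k => by
    rw [tri_def, tri_def, h.xxy, h'.xxy]
  have xyy : ∀ i j k, S.tri (b (.inl i)) (b (.inr j)) (b (.inr k)) =
      T.tri (b' (.inl i)) (b' (.inr j)) (b' (.inr k)) := fun i j k => by
    rcases lt_trichotomy j k with hjk | rfl | hjk
    · rw [tri_def, tri_def, h.xyy i j k hjk, h'.xyy i j k hjk]
    · simp
    · rw [tri_swap_right, tri_swap_right T, tri_def, tri_def, h.xyy i k j hjk, h'.xyy i k j hjk]
  have ylt : ∀ i j k, i < j → j < k → S.tri (b (.inr i)) (b (.inr j)) (b (.inr k)) =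
      T.tri (b' (.inr i)) (b' (.inr j)) (b' (.inr k)) := fun i j k hij hjk => by
    rw [tri_def, tri_def, h.yyy i j k hij hjk, h'.yyy i j k hij hjk]
  have yyy1 : ∀ i j k, i < j → S.tri (b (.inr i)) (b (.inr j)) (b (.inr k)) =
      T.tri (b' (.inr i)) (b' (.inr j)) (b' (.inr k)) := fun i j k hij => by
    rcases lt_trichotomy j k with hjk | rfl | hjk
    · exact ylt i j k hij hjk
    · simp
    · rcases lt_trichotomy i k with hik | rfl | hik
      · rw [tri_swap_right, tri_swap_right T, ylt i k j hik hjk]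
      · simp
      · rw [← tri_cycle, ← tri_cycle T, ylt k i j hik hij]
  have yyy : ∀ i j k, S.tri (b (.inr i)) (b (.inr j)) (b (.inr k)) =
      T.tri (b' (.inr i)) (b' (.inr j)) (b' (.inr k)) := fun i j k => by
    rcases lt_trichotomy i j with hij | rfl | hij
    · exact yyy1 i j k hij
    · simp
    · rw [tri_swap_left, tri_swap_left T, yyy1 j i k hij]
  rcases p with i | i <;> rcases q with j | j <;> rcases s with k | k
  · rw [tri_def, tri_def, h.xxx, h'.xxx]
  · exact xxy i j k
  · rw [← tri_cycle, ← tri_cycle T, xxy]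
  · exact xyy i j k
  · rw [tri_cycle, tri_cycle T, xxy]
  · rw [tri_cycle, tri_cycle T, tri_swap_right, tri_swap_right T, tri_swap_right,
      tri_swap_right T, xyy]
  · rw [← tri_cycle, ← tri_cycle T, xyy]
  · exact yyy i j k

theorem tri_ext {ι : Type*} (b : Module.Basis ι F L) (e : L →ₗ[F] M)
    (h : ∀ p q s, S.tri (b p) (b q) (b s) = T.tri (e (b p)) (e (b q)) (e (b s))) (u v w : L) :
    S.tri u v w = T.tri (e u) (e v) (e w) := by
  have ext1 : ∀ f g : L →ₗ[F] F, (∀ p, f (b p) = g (b p)) → ∀ u, f u = g u :=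
    fun f g hfg u => by rw [b.ext hfg]
  have h1 : ∀ p q w, S.tri (b p) (b q) w = T.tri (e (b p)) (e (b q)) (e w) := fun p q =>
    ext1 (S.form (S.mul (b p) (b q))) ((T.form (T.mul (e (b p)) (e (b q)))).comp e) (h p q)
  have h2 : ∀ p v w, S.tri (b p) v w = T.tri (e (b p)) (e v) (e w) := fun p v w =>
    ext1 ((S.form.flip w).comp (S.mul (b p)))
      (((T.form.flip (e w)).comp (T.mul (e (b p)))).comp e) (fun q => h1 p q w) v
  exact ext1 ((S.form.flip w).comp (S.mul.flip v))
      (((T.form.flip (e w)).comp (T.mul.flip (e v))).comp e) (fun p => h2 p v w) u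

theorem form_ext {ι : Type*} (b : Module.Basis ι F L) (e : L →ₗ[F] M)
    (h : ∀ p q, S.form (b p) (b q) = T.form (e (b p)) (e (b q))) (u v : L) :
    S.form u v = T.form (e u) (e v) := by
  have h1 : ∀ p, S.form (b p) = (T.form (e (b p))).comp e := fun p => b.ext (h p)
  have h2 : S.form.flip v = ((T.form.flip (e v)).comp e) :=
    b.ext fun p => LinearMap.congr_fun (h1 p) v
  exact LinearMap.congr_fun h2 u

/-- Algebras with the same presentation are isomorphic, via the map matching the bases. -/
theorem Satisfies.equiv_form_mul {b : Module.Basis (Fin n ⊕ Fin n) F L}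
    {b' : Module.Basis (Fin n ⊕ Fin n) F M} {α β : Fin n → Fin n → Fin n → F}
    (h : S.Satisfies b α β) (h' : T.Satisfies b' α β) :
    (∀ u v, T.form (b.equiv b' (.refl _) u) (b.equiv b' (.refl _) v) = S.form u v) ∧
      ∀ u v, b.equiv b' (.refl _) (S.mul u v) =
        T.mul (b.equiv b' (.refl _) u) (b.equiv b' (.refl _) v) := by
  set e := b.equiv b' (.refl _) with he
  have heb : ∀ p, e (b p) = b' p := fun p => by simp [he]
  have hform : ∀ u v, T.form (e u) (e v) = S.form u v := fun u v => by
    refine (form_ext b (e : L →ₗ[F] M) (fun p q => ?_) u v).symm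
    simp only [LinearEquiv.coe_coe, heb]
    rcases p with i | i <;> rcases q with j | j
    · rw [h.standard.xx, h'.standard.xx]
    · rw [h.standard.xy, h'.standard.xy]
    · rw [h.standard.yx, h'.standard.yx]
    · rw [h.standard.yy, h'.standard.yy]
  refine ⟨hform, fun u v => ?_⟩
  -- By non-degeneracy, equality of products may be tested by pairing with every vector, where it
  -- becomes equality of `tri`.
  rw [← sub_eq_zero]
  refine T.eq_zero_of_form_left fun w => ?_
  obtain ⟨w, rfl⟩ := e.surjective w
  have := tri_ext (S := S) (T := T) b (e : L →ₗ[F] M)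
    (fun p q s => by simpa only [LinearEquiv.coe_coe, heb] using h.tri_eq h' p q s) u v w
  rw [map_sub, LinearMap.sub_apply, hform, sub_eq_zero]
  exact this

theorem Satisfies.isIsomorphic {b : Module.Basis (Fin n ⊕ Fin n) F L}
    {b' : Module.Basis (Fin n ⊕ Fin n) F M} {α β : Fin n → Fin n → Fin n → F}
    (h : S.Satisfies b α β) (h' : T.Satisfies b' α β) : S.IsIsomorphic T :=
  ⟨b.equiv b' (.refl _), h.equiv_form_mul h'⟩

/-- Presentations are transported along isomorphisms. -/
theorem Satisfies.map {b : Module.Basis (Fin n ⊕ Fin n) F L} {α β : Fin n → Fin n → Fin n → F}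
    (h : S.Satisfies b α β) (e : L ≃ₗ[F] M) (hform : ∀ u v, T.form (e u) (e v) = S.form u v)
    (hmul : ∀ u v, e (S.mul u v) = T.mul (e u) (e v)) : T.Satisfies (b.map e) α β where
  standard :=
    { xx := fun i j => by simp [hform, h.standard.xx]
      yy := fun i j => by simp [hform, h.standard.yy]
      xy := fun i j => by simp [hform, h.standard.xy] }
  xxx := fun i j k => by simp [hform, ← hmul, h.xxx]
  xxy := fun i j k => by simp [hform, ← hmul, h.xxy]
  xyy := fun i j k hjk => by simp [hform, ← hmul, h.xyy i j k hjk]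
  yyy := fun i j k hij hjk => by simp [hform, ← hmul, h.yyy i j k hij hjk]

end generic

/-! ### The descending series of powers. -/

section powers

variable {F L : Type*} [Field F] [AddCommGroup L] [Module F L] (S : SAA F L)

theorem mul_mem_prod {A B : Submodule F L} {a b : L} (ha : a ∈ A) (hb : b ∈ B) :
    S.mul a b ∈ S.prod A B := Submodule.apply_mem_map₂ _ ha hb

theorem prod_le {A B C : Submodule F L} :
    S.prod A B ≤ C ↔ ∀ a ∈ A, ∀ b ∈ B, S.mul a b ∈ C := Submodule.map₂_le

theorem prod_mono {A A' B B' : Submodule F L} (hA : A ≤ A') (hB : B ≤ B') :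
    S.prod A B ≤ S.prod A' B' := Submodule.map₂_le_map₂ hA hB

theorem power_succ {k : ℕ} (hk : 1 ≤ k) : S.power (k + 1) = S.prod (S.power k) ⊤ := by
  obtain ⟨k, rfl⟩ := Nat.exists_eq_add_of_le' hk
  rfl

theorem mul_mem_power_succ {k : ℕ} (hk : 1 ≤ k) {u : L} (hu : u ∈ S.power k) (v : L) :
    S.mul u v ∈ S.power (k + 1) := by
  rw [S.power_succ hk]
  exact S.mul_mem_prod hu trivial

theorem power_one : S.power 1 = ⊤ := rfl

theorem power_antitone : Antitone S.power := by
  refine antitone_nat_of_succ_le fun k => ?_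
  induction k with
  | zero => exact le_top
  | succ k ih =>
    rcases Nat.eq_zero_or_pos k with rfl | hk
    · exact le_top
    · rw [S.power_succ (k := k + 1) (by omega)]
      exact (S.prod_mono ih le_rfl).trans (S.power_succ hk).ge

theorem power_eq_of_succ_eq {k : ℕ} (hk : 1 ≤ k) (h : S.power (k + 1) = S.power k) (m : ℕ) :
    S.power (k + m) = S.power k := by
  induction m with
  | zero => rfl
  | succ m ih =>
    rw [← add_assoc, S.power_succ (by omega), ih, ← S.power_succ hk, h]

end powers

/-! ### A coordinate model for every parameter. -/

section model

variable {F : Type*} [Field F]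

/-- The standard symplectic form on `F¹⁰`. -/
def modelForm (F : Type*) [Field F] : LinearMap.BilinForm F (Fin 5 ⊕ Fin 5 → F) :=
  LinearMap.mk₂ F (fun u v => ∑ i : Fin 5, (u (.inl i) * v (.inr i) - u (.inr i) * v (.inl i)))
    (fun u u' v => by
      rw [← Finset.sum_add_distrib]
      exact Finset.sum_congr rfl fun i _ => by simp only [Pi.add_apply]; ring)
    (fun c u v => by
      rw [smul_eq_mul, Finset.mul_sum]
      exact Finset.sum_congr rfl fun i _ => by simp only [Pi.smul_apply, smul_eq_mul]; ring)
    (fun u v v' => by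
      rw [← Finset.sum_add_distrib]
      exact Finset.sum_congr rfl fun i _ => by simp only [Pi.add_apply]; ring)
    (fun c u v => by
      rw [smul_eq_mul, Finset.mul_sum]
      exact Finset.sum_congr rfl fun i _ => by simp only [Pi.smul_apply, smul_eq_mul]; ring)

theorem modelForm_apply (u v : Fin 5 ⊕ Fin 5 → F) :
    modelForm F u v = ∑ i : Fin 5, (u (.inl i) * v (.inr i) - u (.inr i) * v (.inl i)) := rfl

/-- The minor `u p * v q - u q * v p` of a pair of coordinate vectors. -/
def minor (u v : Fin 5 ⊕ Fin 5 → F) (p q : Fin 5 ⊕ Fin 5) : F := u p * v q - u q * v p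

/-- The product of the algebra with presentation parameter `r`, in coordinates. -/
def modelMulFun (r : F) (u v : Fin 5 ⊕ Fin 5 → F) : Fin 5 ⊕ Fin 5 → F :=
  Sum.elim
    ![minor u v (.inr 1) (.inr 2),
      minor u v (.inr 4) (.inl 0) + minor u v (.inr 2) (.inr 0),
      r * minor u v (.inr 4) (.inl 1) + minor u v (.inr 0) (.inr 1),
      minor u v (.inr 4) (.inl 2),
      r * minor u v (.inl 1) (.inr 2) + minor u v (.inl 2) (.inr 3) +
        minor u v (.inl 0) (.inr 1)]
    ![minor u v (.inr 4) (.inr 1), r * minor u v (.inr 4) (.inr 2), minor u v (.inr 4) (.inr 3),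
      0, 0]

/-- `modelMulFun` as a bilinear map. -/
def modelMul (r : F) :
    (Fin 5 ⊕ Fin 5 → F) →ₗ[F] (Fin 5 ⊕ Fin 5 → F) →ₗ[F] (Fin 5 ⊕ Fin 5 → F) :=
  LinearMap.mk₂ F (modelMulFun r)
    (fun u u' v => by
      ext (i | i) <;> fin_cases i <;> simp [modelMulFun, minor] <;> ring)
    (fun c u v => by
      ext (i | i) <;> fin_cases i <;> simp [modelMulFun, minor] <;> ring)
    (fun u v v' => by
      ext (i | i) <;> fin_cases i <;> simp [modelMulFun, minor] <;> ring)
    (fun c u v => by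
      ext (i | i) <;> fin_cases i <;> simp [modelMulFun, minor] <;> ring)

theorem modelMul_apply (r : F) (u v : Fin 5 ⊕ Fin 5 → F) :
    modelMul r u v = modelMulFun r u v := rfl

/-- The algebra with presentation parameter `r`. -/
def model (r : F) : SAA F (Fin 5 ⊕ Fin 5 → F) where
  form := modelForm F
  form_alt := fun u => by
    rw [modelForm_apply]
    exact Finset.sum_eq_zero fun i _ => by ring
  form_nondegenerate := by
    have hl : (modelForm F).SeparatingLeft := by
      intro u hu
      ext (i | i)
      · simpa [modelForm_apply, Pi.single_apply] using hu (Pi.single (.inr i) 1)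
      · simpa [modelForm_apply, Pi.single_apply] using hu (Pi.single (.inl i) 1)
    refine ⟨hl, fun v hv => hl v fun u => ?_⟩
    rw [← neg_eq_zero, ← hv u, modelForm_apply, modelForm_apply, ← Finset.sum_neg_distrib]
    exact Finset.sum_congr rfl fun i _ => by ring
  mul := modelMul r
  mul_alt := fun u => by
    have h : ∀ p q, minor u u p q = 0 := fun p q => by rw [minor]; ring
    rw [modelMul_apply]
    ext (i | i) <;> fin_cases i <;> simp [modelMulFun, h]
  form_mul := fun u v w => by
    simp only [modelForm_apply, modelMul_apply, Fin.sum_univ_five, modelMulFun, minor,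
      Sum.elim_inl, Sum.elim_inr, Matrix.cons_val]
    ring

theorem tri_model (r : F) (u v w : Fin 5 ⊕ Fin 5 → F) :
    (model r).tri u v w = modelForm F (modelMulFun r u v) w := rfl

set_option maxHeartbeats 1000000 in
theorem model_satisfies (r : F) :
    (model r).Satisfies (Pi.basisFun F (Fin 5 ⊕ Fin 5)) (alphaP r) betaP where
  standard :=
    { xx := fun i j => by simp [model, modelForm_apply]
      yy := fun i j => by simp [model, modelForm_apply]
      xy := fun i j => by simp [model, modelForm_apply, Pi.single_apply, eq_comm] }
  xxx := fun i j k => by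
    rw [← tri_def, tri_model]
    simp [modelForm_apply, modelMulFun, minor, Fin.sum_univ_five]
  xxy := fun i j k => by
    rw [← tri_def, tri_model]
    simp [modelForm_apply, modelMulFun, minor, Fin.sum_univ_five]
  xyy := fun i j k hjk => by
    rw [← tri_def, tri_model]
    fin_cases j <;> fin_cases k <;> simp at hjk <;> fin_cases i <;>
    simp [modelForm_apply, modelMulFun, minor, Fin.sum_univ_five, alphaP]
  yyy := fun i j k hij hjk => by
    rw [← tri_def, tri_model]
    fin_cases j <;> fin_cases k <;> simp at hjk <;> fin_cases i <;> simp at hij <;>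
    simp [modelForm_apply, modelMulFun, minor, Fin.sum_univ_five, betaP]

end model

/-! ### Invariants of a presented algebra. -/

section presented

variable {F L : Type*} [Field F] [AddCommGroup L] [Module F L] {S : SAA F L} {r : F}
  {b : Module.Basis (Fin 5 ⊕ Fin 5) F L}

/-- The coordinate map of `b` matches `b` with the basis of the model, which has the same
presentation; it is therefore an isomorphism, and all calculations reduce to coordinates. -/
theorem repr_mul (h : S.Satisfies b (alphaP r) betaP) (u v : L) (p : Fin 5 ⊕ Fin 5) :
    b.repr (S.mul u v) p = modelMulFun r (b.repr u) (b.repr v) p := by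
  have he : b.equiv (Pi.basisFun F (Fin 5 ⊕ Fin 5)) (.refl _) = b.equivFun := by
    refine b.ext' fun p => ?_
    ext q
    simp [Pi.single_apply, eq_comm]
  have := (h.equiv_form_mul (model_satisfies r)).2 u v
  rw [he] at this
  exact congrFun this p

theorem form_eq_repr (h : S.Satisfies b (alphaP r) betaP) (u v : L) :
    S.form u v = modelForm F (b.repr u) (b.repr v) := by
  have he : b.equiv (Pi.basisFun F (Fin 5 ⊕ Fin 5)) (.refl _) = b.equivFun := by
    refine b.ext' fun p => ?_
    ext q
    simp [Pi.single_apply, eq_comm]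
  have := (h.equiv_form_mul (model_satisfies r)).1 u v
  rw [he] at this
  exact this.symm

theorem tri_eq_repr (h : S.Satisfies b (alphaP r) betaP) (u v w : L) :
    S.tri u v w = modelForm F (modelMulFun r (b.repr u) (b.repr v)) (b.repr w) := by
  rw [tri_def, form_eq_repr h]
  congr 2
  ext p
  exact repr_mul h u v p

/-- The span of the basis vectors with index in `A`. -/
def coordSpan (b : Module.Basis (Fin 5 ⊕ Fin 5) F L) (A : Finset (Fin 5 ⊕ Fin 5)) :
    Submodule F L := Submodule.span F (b '' A)

theorem mem_coordSpan {A : Finset (Fin 5 ⊕ Fin 5)} {v : L} :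
    v ∈ coordSpan b A ↔ ∀ p ∉ A, b.repr v p = 0 := by
  rw [coordSpan, b.mem_span_image]
  simp only [Set.subset_def, SetLike.mem_coe, Finsupp.mem_support_iff]
  exact forall_congr' fun p => not_imp_comm

theorem basis_mem_coordSpan {A : Finset (Fin 5 ⊕ Fin 5)} {p : Fin 5 ⊕ Fin 5} (hp : p ∈ A) :
    b p ∈ coordSpan b A := Submodule.subset_span ⟨p, hp, rfl⟩

theorem finrank_coordSpan (A : Finset (Fin 5 ⊕ Fin 5)) :
    Module.finrank F (coordSpan b A) = A.card := by
  have hb := b.linearIndependent.comp (Subtype.val (p := (· ∈ (A : Set (Fin 5 ⊕ Fin 5)))))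
    Subtype.val_injective
  rw [coordSpan, ← Subtype.range_coe (s := (A : Set (Fin 5 ⊕ Fin 5))), ← Set.range_comp,
    finrank_span_eq_card hb]
  simp

theorem coordSpan_le {A : Finset (Fin 5 ⊕ Fin 5)} {N : Submodule F L} :
    coordSpan b A ≤ N ↔ ∀ p ∈ A, b p ∈ N := by
  rw [coordSpan, Submodule.span_le]
  exact Set.image_subset_iff

theorem coordSpan_univ : coordSpan b Finset.univ = ⊤ := by
  rw [coordSpan, Finset.coe_univ, Set.image_univ, b.span_eq]

theorem coordSpan_injective : Function.Injective (coordSpan b) := fun A B hAB => by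
  ext p
  have : ∀ C : Finset (Fin 5 ⊕ Fin 5), p ∈ C ↔ b p ∈ coordSpan b C := fun C => by
    refine ⟨basis_mem_coordSpan, fun h => ?_⟩
    by_contra hp
    simpa using mem_coordSpan.1 h p hp
  rw [this, this, hAB]

theorem coordSpan_mono {A B : Finset (Fin 5 ⊕ Fin 5)} (h : A ⊆ B) :
    coordSpan b A ≤ coordSpan b B := Submodule.span_mono (Set.image_mono h)

/-- Multiplication table of the presented algebra, up to the zero products. -/
theorem mul_table (h : S.Satisfies b (alphaP r) betaP) :
    S.mul (b (.inr 1)) (b (.inr 2)) = b (.inl 0) ∧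
    S.mul (b (.inr 2)) (b (.inr 0)) = b (.inl 1) ∧
    S.mul (b (.inr 4)) (b (.inl 0)) = b (.inl 1) ∧
    S.mul (b (.inr 0)) (b (.inr 1)) = b (.inl 2) ∧
    S.mul (b (.inr 4)) (b (.inl 1)) = r • b (.inl 2) ∧
    S.mul (b (.inr 4)) (b (.inl 2)) = b (.inl 3) ∧
    S.mul (b (.inl 2)) (b (.inr 3)) = b (.inl 4) ∧
    S.mul (b (.inl 0)) (b (.inr 1)) = b (.inl 4) ∧
    S.mul (b (.inl 1)) (b (.inr 2)) = r • b (.inl 4) ∧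
    S.mul (b (.inr 4)) (b (.inr 1)) = b (.inr 0) ∧
    S.mul (b (.inr 4)) (b (.inr 2)) = r • b (.inr 1) ∧
    S.mul (b (.inr 4)) (b (.inr 3)) = b (.inr 2) := by
  refine ⟨?_, ?_, ?_, ?_, ?_, ?_, ?_, ?_, ?_, ?_, ?_, ?_⟩ <;>
  · apply b.repr.injective
    ext (p | p) <;> rw [repr_mul h] <;> fin_cases p <;>
      simp [modelMulFun, minor]

/-- The largest `k` such that the basis vector with index `p` lies in the `k`-th power. -/
def depth : Fin 5 ⊕ Fin 5 → ℕ := Sum.elim ![4, 5, 6, 7, 7] ![4, 3, 2, 1, 1]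

/-- The basis indices of depth at least `k`. -/
def deep (k : ℕ) : Finset (Fin 5 ⊕ Fin 5) := Finset.univ.filter fun p => k ≤ depth p

theorem mem_coordSpan_deep {k : ℕ} {u : L} :
    u ∈ coordSpan b (deep k) ↔ ∀ p, depth p < k → b.repr u p = 0 := by
  simp [mem_coordSpan, deep]

/-- Multiplication strictly increases depth, and each basis vector of depth at least 2 is, up to a
non-zero scalar, a product with a factor of depth exactly one less. For two of these vectors the
scalar is -r, which is where `hr` enters. -/
theorem power_eq_coordSpan (hr : r ≠ 0) (h : S.Satisfies b (alphaP r) betaP) {k : ℕ} (hk : 1 ≤ k) :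
    S.power k = coordSpan b (deep k) := by
  induction k, hk using Nat.le_induction with
  | base =>
    have : deep 1 = Finset.univ := by decide
    rw [this, coordSpan_univ, power_one]
  | succ k hk ih =>
    rw [S.power_succ hk, ih]
    apply le_antisymm
    · refine S.prod_le.2 fun u hu v _ => ?_
      rw [mem_coordSpan_deep] at hu ⊢
      intro p hp
      -- Coordinate `p` of a product is built from minors in coordinates of depth smaller than that
      -- of `p`, and these all vanish on `u`.
      have hz : ∀ q, depth q < depth p → b.repr u q = 0 := fun q hq => hu q (by omega)
      rw [repr_mul h]
      clear hp
      rcases p with p | p <;> fin_cases p <;>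
        simp [Sum.forall, Fin.forall_fin_succ, depth] at hz <;>
        simp [modelMulFun, minor, hz]
    · rw [coordSpan_le]
      intro p hp
      have key : ∀ (q s : Fin 5 ⊕ Fin 5) (c : F), c ≠ 0 → depth q + 1 = depth p → S.mul (b q) (b s) = c • b p →
          b p ∈ S.prod (coordSpan b (deep k)) ⊤ := by
        intro q s c hc hq hmul
        rw [← Submodule.smul_mem_iff _ hc, ← hmul]
        refine S.mul_mem_prod (basis_mem_coordSpan ?_) trivial
        simp only [deep, Finset.mem_filter, Finset.mem_univ, true_and] at hp ⊢
        omega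
      have hp1 : 2 ≤ depth p := by
        simp only [deep, Finset.mem_filter, Finset.mem_univ, true_and] at hp
        omega
      obtain ⟨t1, t2, t3, t4, t5, t6, t7, t8, t9, t10, t11, t12⟩ := mul_table h
      clear hp
      rcases p with p | p <;> fin_cases p
      · exact key (.inr 1) (.inr 2) 1 one_ne_zero rfl (by simpa using t1)
      · exact key (.inl 0) (.inr 4) (-1) (by simp) rfl (by simpa [S.mul_swap _ (b (.inr 4))] using t3)
      · exact key (.inl 1) (.inr 4) (-r) (by simpa) rfl (by simpa [S.mul_swap _ (b (.inr 4))] using t5)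
      · exact key (.inl 2) (.inr 4) (-1) (by simp) rfl (by simpa [S.mul_swap _ (b (.inr 4))] using t6)
      · exact key (.inl 2) (.inr 3) 1 one_ne_zero rfl (by simpa using t7)
      · exact key (.inr 1) (.inr 4) (-1) (by simp) rfl (by simpa [S.mul_swap _ (b (.inr 4))] using t10)
      · exact key (.inr 2) (.inr 4) (-r) (by simpa) rfl (by simpa [S.mul_swap _ (b (.inr 4))] using t11)
      · exact key (.inr 3) (.inr 4) (-1) (by simp) rfl (by simpa [S.mul_swap _ (b (.inr 4))] using t12)
      · simp [depth] at hp1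
      · simp [depth] at hp1

theorem prod_power_five_two (hr : r ≠ 0) (h : S.Satisfies b (alphaP r) betaP) :
    S.prod (S.power 5) (S.power 2) = coordSpan b {.inl 4} := by
  rw [power_eq_coordSpan hr h (by norm_num), power_eq_coordSpan hr h (by norm_num)]
  apply le_antisymm
  · refine S.prod_le.2 fun u hu v hv => ?_
    rw [mem_coordSpan_deep] at hu hv
    simp [Sum.forall, Fin.forall_fin_succ, depth] at hu hv
    simp [mem_coordSpan, repr_mul h, Sum.forall, Fin.forall_fin_succ, modelMulFun, minor, hu, hv]
  · rw [coordSpan_le]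
    intro p hp
    obtain rfl := Finset.mem_singleton.1 hp
    rw [← Submodule.smul_mem_iff _ hr, ← (mul_table h).2.2.2.2.2.2.2.2.1]
    exact S.mul_mem_prod (basis_mem_coordSpan (by decide)) (basis_mem_coordSpan (by decide))

theorem prod_power_four_three (hr : r ≠ 0) (h : S.Satisfies b (alphaP r) betaP) :
    S.prod (S.power 4) (S.power 3) = coordSpan b {.inl 2, .inl 4} := by
  rw [power_eq_coordSpan hr h (by norm_num), power_eq_coordSpan hr h (by norm_num)]
  apply le_antisymm
  · refine S.prod_le.2 fun u hu v hv => ?_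
    rw [mem_coordSpan_deep] at hu hv
    simp [Sum.forall, Fin.forall_fin_succ, depth] at hu hv
    simp [mem_coordSpan, repr_mul h, Sum.forall, Fin.forall_fin_succ, modelMulFun, minor, hu, hv]
  · rw [coordSpan_le]
    intro p hp
    simp only [Finset.mem_insert, Finset.mem_singleton] at hp
    rcases hp with rfl | rfl
    · rw [← (mul_table h).2.2.2.1]
      exact S.mul_mem_prod (basis_mem_coordSpan (by decide)) (basis_mem_coordSpan (by decide))
    · rw [← (mul_table h).2.2.2.2.2.2.2.1]
      exact S.mul_mem_prod (basis_mem_coordSpan (by decide)) (basis_mem_coordSpan (by decide))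

theorem firstMeeting_eq (hr : r ≠ 0) (h : S.Satisfies b (alphaP r) betaP) :
    S.firstMeeting = coordSpan b {.inl 4} := by
  rw [firstMeeting, if_pos, prod_power_five_two hr h]
  rw [prod_power_five_two hr h, prod_power_four_three hr h,
    inf_eq_left.2 (coordSpan_mono (by decide))]
  intro h0
  have := basis_mem_coordSpan (b := b) (Finset.mem_singleton_self (Sum.inl 4 : Fin 5 ⊕ Fin 5))
  rw [h0, Submodule.mem_bot] at this
  exact b.ne_zero _ this

theorem mem_transporter {A B C : Submodule F L} {x : L} :
    x ∈ S.transporter A B C ↔ x ∈ A ∧ ∀ b ∈ B, S.mul x b ∈ C := Iff.rfl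

theorem idealU_eq (hr : r ≠ 0) (h : S.Satisfies b (alphaP r) betaP) :
    S.idealU = coordSpan b (Finset.univ.image Sum.inl) := by
  rw [idealU, firstMeeting_eq hr h, power_eq_coordSpan hr h (by norm_num),
    power_eq_coordSpan hr h (by norm_num)]
  ext u
  rw [mem_transporter]
  constructor
  · rintro ⟨hu, hu3⟩
    -- In L^4 only the y_0-coordinate has to be excluded. Multiplying by y_1 ∈ L^3 detects it, since
    -- y_0y_1 = x_2 lies outside the span of x_4.
    have := hu3 (b (.inr 1)) (basis_mem_coordSpan (by decide))
    rw [mem_coordSpan_deep] at hu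
    rw [mem_coordSpan] at this ⊢
    have := this (.inl 2) (by decide)
    simp [Sum.forall, Fin.forall_fin_succ, depth] at hu
    simp [repr_mul h, modelMulFun, minor, hu] at this
    simp [Sum.forall, Fin.forall_fin_succ, hu, this]
  · intro hu
    refine ⟨coordSpan_mono (by decide) hu, fun v hv => ?_⟩
    rw [mem_coordSpan_deep] at hv
    rw [mem_coordSpan] at hu
    simp [Sum.forall, Fin.forall_fin_succ, depth] at hu hv
    simp [mem_coordSpan, repr_mul h, Sum.forall, Fin.forall_fin_succ, modelMulFun, minor, hu, hv]

theorem prod_idealU (hr : r ≠ 0) (h : S.Satisfies b (alphaP r) betaP) :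
    S.prod S.idealU (S.power 2) = coordSpan b {.inl 4} := by
  rw [idealU_eq hr h, power_eq_coordSpan hr h (by norm_num)]
  apply le_antisymm
  · refine S.prod_le.2 fun u hu v hv => ?_
    rw [mem_coordSpan_deep] at hv
    rw [mem_coordSpan] at hu
    simp [Sum.forall, Fin.forall_fin_succ, depth] at hu hv
    simp [mem_coordSpan, repr_mul h, Sum.forall, Fin.forall_fin_succ, modelMulFun, minor, hu, hv]
  · rw [coordSpan_le]
    intro p hp
    obtain rfl := Finset.mem_singleton.1 hp
    rw [← (mul_table h).2.2.2.2.2.2.2.1]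
    exact S.mul_mem_prod (basis_mem_coordSpan (by decide)) (basis_mem_coordSpan (by decide))

theorem center_eq (hr : r ≠ 0) (h : S.Satisfies b (alphaP r) betaP) :
    S.center = coordSpan b {.inl 3, .inl 4} := by
  ext u
  rw [center, LinearMap.mem_ker, mem_coordSpan]
  constructor
  · intro hu
    have h4 : ∀ p, b.repr (S.mul u (b (.inr 4))) p = 0 := fun p => by simp [hu]
    have h3 : ∀ p, b.repr (S.mul u (b (.inr 3))) p = 0 := fun p => by simp [hu]
    have h2 : ∀ p, b.repr (S.mul u (b (.inr 2))) p = 0 := fun p => by simp [hu]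
    have h1 : ∀ p, b.repr (S.mul u (b (.inr 1))) p = 0 := fun p => by simp [hu]
    simp [repr_mul h, Sum.forall, Fin.forall_fin_succ, modelMulFun, minor, hr] at h1 h2 h3 h4
    simp [Sum.forall, Fin.forall_fin_succ]
    tauto
  · intro hu
    ext v
    apply b.repr.injective
    simp [Sum.forall, Fin.forall_fin_succ] at hu
    ext p
    rw [repr_mul h]
    rcases p with p | p <;> fin_cases p <;> simp [modelMulFun, minor, hu]

theorem inFamily_of_satisfies (hr : r ≠ 0) (h : S.Satisfies b (alphaP r) betaP) : S.InFamily where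
  finrank_eq := by simp [Module.finrank_eq_card_basis b]
  nilpotent := by
    constructor
    · change S.power 8 = ⊥
      have : deep 8 = ∅ := by decide
      rw [power_eq_coordSpan hr h (by norm_num), this]
      simp [coordSpan]
    · intro k hk
      by_contra hlt
      have h7 : S.power 7 ≤ ⊥ := by
        rw [← (show S.power (k + 1) = ⊥ from hk)]
        exact S.power_antitone (by omega)
      rw [power_eq_coordSpan hr h (by norm_num), coordSpan_le] at h7
      exact b.ne_zero (.inl 4) (h7 (.inl 4) (by decide))
  center_isotropic := by
    intro u hu v hv
    rw [center_eq hr h, mem_coordSpan] at hu hv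
    simp [Sum.forall, Fin.forall_fin_succ] at hu hv
    simp [form_eq_repr h, modelForm_apply, Fin.sum_univ_five, hu, hv]
  finrank_center := by
    rw [center_eq hr h, finrank_coordSpan]
    decide
  prod43_ne := by
    rw [prod_power_four_three hr h, power_eq_coordSpan hr h (by norm_num)]
    intro heq
    exact absurd (coordSpan_injective heq) (by decide)
  prod52_le := by
    rw [prod_power_four_three hr h, prod_power_five_two hr h]
    exact coordSpan_mono (by decide)
  finrank_U := by
    rw [prod_idealU hr h, finrank_coordSpan]
    decide

/-- The parameters of two presentations of the same algebra differ by a cube. -/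
theorem Satisfies.exists_cube {s : F} {b' : Module.Basis (Fin 5 ⊕ Fin 5) F L} (hr : r ≠ 0)
    (hs : s ≠ 0) (h : S.Satisfies b (alphaP r) betaP) (h' : S.Satisfies b' (alphaP s) betaP) :
    ∃ a : F, a ≠ 0 ∧ s / r = a ^ 3 := by
  -- The powers do not depend on the presentation, so a new basis vector involves only old ones that
  -- are at least as deep.
  have hdeep : ∀ k, 1 ≤ k → ∀ p ∈ deep k, ∀ q, depth q < k → b.repr (b' p) q = 0 :=
    fun k hk p hp => by
      rw [← mem_coordSpan_deep, ← power_eq_coordSpan hr h hk, power_eq_coordSpan hs h' hk]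
      exact basis_mem_coordSpan hp
  have hx1 := hdeep 5 (by norm_num) (.inl 1) (by decide)
  have hy0 := hdeep 4 (by norm_num) (.inr 0) (by decide)
  have hy1 := hdeep 3 (by norm_num) (.inr 1) (by decide)
  have hy2 := hdeep 2 (by norm_num) (.inr 2) (by decide)
  -- Depth alone does not separate x_0 from y_0, both of depth 4; the invariance of U does.
  have hx0 : ∀ p ∉ Finset.univ.image Sum.inl, b.repr (b' (.inl 0)) p = 0 := by
    rw [← mem_coordSpan, ← idealU_eq hr h, idealU_eq hs h']
    exact basis_mem_coordSpan (by decide)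
  have e1 := h'.xyy 1 2 4 (by decide)
  have e2 := h'.xyy 0 1 4 (by decide)
  have e3 := h'.yyy 0 1 2 (by decide) (by decide)
  have f0 := h'.standard.xy 0 0
  have f1 := h'.standard.xy 1 1
  rw [← tri_def, tri_eq_repr h] at e1 e2 e3
  rw [form_eq_repr h] at f0 f1
  simp [Sum.forall, Fin.forall_fin_succ, depth] at hx0 hx1 hy0 hy1 hy2
  simp [modelForm_apply, Fin.sum_univ_five, modelMulFun, minor, hx0, hx1, hy0, hy1, hy2, alphaP,
    betaP] at e1 e2 e3 f0 f1
  -- Only diagonal coefficients survive: r X1 Y2 Y4 = s, X0 Y1 Y4 = 1, Y0 Y1 Y2 = 1 and X0 Y0 = X1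
  -- Y1 = 1. Eliminating everything but X1 leaves s = r X1^3.
  generalize b.repr (b' (.inl 0)) (.inl 0) = X0 at *
  generalize b.repr (b' (.inl 1)) (.inl 1) = X1 at *
  generalize b.repr (b' (.inr 0)) (.inr 0) = Y0 at *
  generalize b.repr (b' (.inr 1)) (.inr 1) = Y1 at *
  generalize b.repr (b' (.inr 2)) (.inr 2) = Y2 at *
  generalize b.repr (b' (.inr 4)) (.inr 4) = Y4 at *
  have hY2 : Y2 = X0 * X1 := by
    linear_combination X0 * X1 * e3 - Y2 * (X1 * Y1 * f0 + f1)
  have hY4 : Y4 = X1 * Y0 := by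
    linear_combination X1 * Y0 * e2 - Y4 * (X1 * Y1 * f0 + f1)
  refine ⟨X1, left_ne_zero_of_mul_eq_one f1, ?_⟩
  rw [div_eq_iff hr, ← e1, hY2, hY4]
  linear_combination r * X1 ^ 3 * f0

end presented

/-! ### From a chain to a presentation. -/

section chain

variable {F L : Type*} [Field F] [AddCommGroup L] [Module F L]

/-- Dual families `x`, `y`, with `x` in an isotropic subspace `U` that multiplies trivially with
itself, on which multiplication by `y 4` shifts `x 0, …, x 3`, such that the triple values on the
hyperplane orthogonal to `x 4` are determined by `y 0`, `y 1`, `y 2`. -/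
structure IsChain (S : SAA F L) (U : Submodule F L) (x y : Fin 5 → L) : Prop where
  mem : ∀ i, x i ∈ U
  isotropic : S.IsIsotropic U
  dual : ∀ i j, S.form (x i) (y j) = if i = j then 1 else 0
  mul_self : ∀ u ∈ U, ∀ v ∈ U, ∀ w, S.tri u v w = 0
  tri_left : ∀ u ∈ U, ∀ v w, S.form (x 4) v = 0 → S.form (x 4) w = 0 → S.tri u v w = 0
  tri_three : ∀ v w, S.form (x 4) v = 0 → S.form (x 4) w = 0 → S.tri (y 3) v w = 0
  mul_zero : S.mul (y 4) (x 0) = x 1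
  mul_one : S.mul (y 4) (x 1) = x 2
  mul_two : S.mul (y 4) (x 2) = x 3
  mul_three : S.mul (y 4) (x 3) = 0
  mul_four : S.mul (y 4) (x 4) = 0
  tri_ne : S.tri (y 0) (y 1) (y 2) ≠ 0

variable {S : SAA F L} {U : Submodule F L} {x y : Fin 5 → L}

theorem IsChain.dual' (h : S.IsChain U x y) (i j : Fin 5) :
    S.form (y i) (x j) = if i = j then -1 else 0 := by
  rw [S.form_swap, h.dual]
  by_cases hij : i = j
  · simp [hij]
  · simp [hij, Ne.symm hij]

/-- Since UU = 0, every term of the expansion with two arguments in U vanishes, so shears modulo U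
act on `tri` to first order only. -/
theorem IsChain.tri_shear (h : S.IsChain U x y) {u u' u'' : L} (hu : u ∈ U) (hu' : u' ∈ U)
    (hu'' : u'' ∈ U) (a b c : L) : S.tri (a + u) (b + u') (c + u'') =
      S.tri a b c + S.tri u b c + S.tri a u' c + S.tri a b u'' := by
  have h1 := h.mul_self
  have h2 : ∀ v, S.tri u v u'' = 0 := fun v => by rw [tri_swap_right, h1 _ hu _ hu'', neg_zero]
  have h3 : ∀ v, S.tri v u' u'' = 0 := fun v => by rw [tri_cycle, h1 _ hu' _ hu'']
  simp only [tri_add_left, tri_add_mid, tri_add_right, h1 _ hu _ hu', h2, h3]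
  ring

theorem IsChain.add_mem (h : S.IsChain U x y) (μ : Fin 5 → Fin 5 → F) (i : Fin 5) :
    ∑ k, μ i k • x k ∈ U := U.sum_mem fun k _ => U.smul_mem _ (h.mem k)

/-- The vectors `y i` may be changed modulo `U`. -/
theorem IsChain.add (h : S.IsChain U x y) (μ : Fin 5 → Fin 5 → F) (hμ : ∀ k, μ 4 k = 0) :
    S.IsChain U x fun i => y i + ∑ k, μ i k • x k where
  mem := h.mem
  isotropic := h.isotropic
  dual := fun i j => by
    rw [map_add, h.dual, h.isotropic _ (h.mem i) _ (h.add_mem μ j), add_zero]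
  mul_self := h.mul_self
  tri_left := h.tri_left
  tri_three := fun v w hv hw => by
    rw [tri_add_left, h.tri_three v w hv hw, h.tri_left _ (h.add_mem μ 3) v w hv hw, add_zero]
  mul_zero := by simpa [hμ] using h.mul_zero
  mul_one := by simpa [hμ] using h.mul_one
  mul_two := by simpa [hμ] using h.mul_two
  mul_three := by simpa [hμ] using h.mul_three
  mul_four := by simpa [hμ] using h.mul_four
  tri_ne := by
    have d0 : S.form (x 4) (y 0) = 0 := by simp [h.dual]
    have d1 : S.form (x 4) (y 1) = 0 := by simp [h.dual]
    have d2 : S.form (x 4) (y 2) = 0 := by simp [h.dual]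
    have t1 := h.tri_left _ (h.add_mem μ 0) _ _ d1 d2
    have t2 := h.tri_left _ (h.add_mem μ 1) _ _ d2 d0
    have t3 := h.tri_left _ (h.add_mem μ 2) _ _ d0 d1
    rw [← tri_cycle] at t2
    rw [tri_cycle] at t3
    rw [h.tri_shear (h.add_mem μ 0) (h.add_mem μ 1) (h.add_mem μ 2), t1, t2, t3]
    simpa using h.tri_ne

theorem IsChain.form_add (h : S.IsChain U x y) (μ : Fin 5 → Fin 5 → F) (i j : Fin 5) :
    S.form (y i + ∑ k, μ i k • x k) (y j + ∑ k, μ j k • x k) =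
      S.form (y i) (y j) + μ i j - μ j i := by
  have h1 : S.form (∑ k, μ i k • x k) (y j) = μ i j := by
    simp [map_sum, LinearMap.sum_apply, h.dual]
  have h2 : S.form (y i) (∑ k, μ j k • x k) = -μ j i := by
    simp [map_sum, h.dual']
  rw [map_add, map_add, LinearMap.add_apply, LinearMap.add_apply, h1, h2,
    h.isotropic _ (h.add_mem μ i) _ (h.add_mem μ j)]
  ring

/-- For u in U one has (uv, y_4) = (y_4u, v), and multiplication by y_4 shifts the chain; the
correction is therefore a shifted copy of the coefficients `μ`. -/
theorem IsChain.tri_add (h : S.IsChain U x y) (μ : Fin 5 → Fin 5 → F) (i j : Fin 5) :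
    S.tri (y i + ∑ k, μ i k • x k) (y j + ∑ k, μ j k • x k) (y 4) =
      S.tri (y i) (y j) (y 4) + S.form (μ i 0 • x 1 + μ i 1 • x 2 + μ i 2 • x 3) (y j) -
        S.form (μ j 0 • x 1 + μ j 1 • x 2 + μ j 2 • x 3) (y i) := by
  have key : ∀ i, S.mul (y 4) (∑ k, μ i k • x k) = μ i 0 • x 1 + μ i 1 • x 2 + μ i 2 • x 3 :=
    fun i => by
      simp [Fin.sum_univ_five, h.mul_zero, h.mul_one, h.mul_two, h.mul_three, h.mul_four]
  have key' : ∀ i v, S.tri (∑ k, μ i k • x k) v (y 4) =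
      S.form (μ i 0 • x 1 + μ i 1 • x 2 + μ i 2 • x 3) v := fun i v => by
    rw [← tri_cycle, tri_def, key]
  have := h.tri_shear (h.add_mem μ i) (h.add_mem μ j) U.zero_mem (y i) (y j) (y 4)
  rw [add_zero] at this
  rw [this, S.tri_swap_left (y i) (∑ k, μ j k • x k), key', key', tri_def S _ _ 0, map_zero]
  ring

/-- The chain can be chosen such that `y` is isotropic. -/
theorem IsChain.exists_isotropic (h : S.IsChain U x y) :
    ∃ y', S.IsChain U x y' ∧ ∀ i j, S.form (y' i) (y' j) = 0 := by
  -- A shear changes (y_i, y_j) by μ_ij - μ_ji, so a strictly upper triangular `μ` corrects each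
  -- pair independently. Its last row is zero, which keeps y_4 fixed.
  let μ : Fin 5 → Fin 5 → F := fun i j => if i < j then -S.form (y i) (y j) else 0
  refine ⟨_, h.add μ fun k => if_neg (by omega), fun i j => ?_⟩
  rw [h.form_add]
  rcases lt_trichotomy i j with hij | rfl | hij
  · simp [μ, hij, hij.not_gt]
  · simp [μ, S.form_self]
  · simp [μ, hij, hij.not_gt, S.form_swap (y i) (y j)]

/-- The chain can be chosen such that `y` is isotropic and has no triple values involving
`y 4`. -/
theorem IsChain.exists_tri_four_eq_zero (h : S.IsChain U x y)
    (hy : ∀ i j, S.form (y i) (y j) = 0) :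
    ∃ y', S.IsChain U x y' ∧ (∀ i j, S.form (y' i) (y' j) = 0) ∧
      ∀ i j, S.tri (y' i) (y' j) (y' 4) = 0 := by
  let β : Fin 5 → Fin 5 → F := fun i j => S.tri (y i) (y j) (y 4)
  -- Symmetry of `μ` preserves isotropy. For i < j ≤ 3 the value β_ij changes by μ_{i,j-1} -
  -- μ_{j,i-1}, the second term being absent when i = 0. The pairs with i = 0 fix the first row;
  -- symmetry then puts -β 0 3 into μ_20, and μ_11 must compensate for it in the equation for (1,
  -- 2).
  let μ : Fin 5 → Fin 5 → F :=
    ![![-β 0 1, -β 0 2, -β 0 3, 0, 0], ![-β 0 2, -β 0 3 - β 1 2, -β 1 3, 0, 0],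
      ![-β 0 3, -β 1 3, -β 2 3, 0, 0], 0, 0]
  have hμ : ∀ k, μ 4 k = 0 := fun k => rfl
  have hsymm : ∀ i j, μ i j = μ j i := fun i j => by
    fin_cases i <;> fin_cases j <;> rfl
  have h4 : y 4 + ∑ k, μ 4 k • x k = y 4 := by simp [hμ]
  refine ⟨_, h.add μ hμ, fun i j => ?_, ?_⟩
  · rw [h.form_add, hy, hsymm i j]
    ring
  · have hlt : ∀ i j, i < j → S.tri (y i + ∑ k, μ i k • x k) (y j + ∑ k, μ j k • x k)
        (y 4 + ∑ k, μ 4 k • x k) = 0 := by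
      intro i j hij
      by_cases hj : j = 4
      · subst hj
        rw [tri_self_right]
      rw [h4, h.tri_add]
      fin_cases j <;> simp at hij hj <;> fin_cases i <;> simp at hij <;>
        simp [h.dual, μ, β]
    intro i j
    rcases lt_trichotomy i j with hij | rfl | hij
    · exact hlt i j hij
    · simp
    · rw [tri_swap_left, hlt j i hij, neg_zero]

theorem IsChain.exists_presentation (h : S.IsChain U x y) (hdim : Module.finrank F L = 10) :
    ∃ r : F, r ≠ 0 ∧ S.HasPresentation r := by
  obtain ⟨y, h, hy⟩ := h.exists_isotropic
  obtain ⟨y, h, hy, h4⟩ := h.exists_tri_four_eq_zero hy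
  obtain ⟨b, hbx, hby, hb⟩ := S.exists_basis_of_standard (by norm_num) hdim
    (fun i j => h.isotropic _ (h.mem i) _ (h.mem j)) hy h.dual
  set q := S.tri (y 0) (y 1) (y 2) with hq
  have hH : ∀ i, i ≠ 4 → S.form (x 4) (y i) = 0 := fun i hi => by
    rw [h.dual, if_neg (Ne.symm hi)]
  have hxy : ∀ i j k, j ≠ 4 → k ≠ 4 → S.tri (x i) (y j) (y k) = 0 := fun i j k hj hk =>
    h.tri_left _ (h.mem i) _ _ (hH j hj) (hH k hk)
  have hxy4 : ∀ i j, S.tri (x i) (y j) (y 4) = S.form (S.mul (y 4) (x i)) (y j) := fun i j => by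
    rw [← tri_cycle, tri_def]
  have hsat : S.Satisfies b (fun i j k => if k = 4 ∧ (i : ℕ) + 1 = j ∧ j < 4 then 1 else 0)
      (fun i j k => if (i, j, k) = (0, 1, 2) then q else 0) :=
    { standard := hb
      xxx := fun i j k => by
        rw [← tri_def, hbx, hbx, hbx, h.mul_self _ (h.mem i) _ (h.mem j)]
      xxy := fun i j k => by
        rw [← tri_def, hbx, hbx, hby, h.mul_self _ (h.mem i) _ (h.mem j)]
      xyy := fun i j k hjk => by
        rw [← tri_def, hbx, hby, hby]
        by_cases hk : k = 4
        · subst hk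
          rw [hxy4]
          fin_cases i <;> fin_cases j <;> simp at hjk <;>
            simp [h.mul_zero, h.mul_one, h.mul_two, h.mul_three, h.mul_four, h.dual]
        · rw [hxy i j k (by omega) hk]
          simp [hk]
      yyy := fun i j k hij hjk => by
        rw [← tri_def, hby, hby, hby]
        by_cases hk : k = 4
        · subst hk
          simp [h4]
        by_cases hk3 : k = 3
        · subst hk3
          rw [← tri_cycle, h.tri_three _ _ (hH i (by omega)) (hH j (by omega))]
          simp
        obtain ⟨rfl, rfl, rfl⟩ : i = 0 ∧ j = 1 ∧ k = 2 := by omega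
        simp [hq] }
  have hq0 : q ≠ 0 := h.tri_ne
  -- Scaling x_2, x_3 by q and y_2, y_3 by q⁻¹ turns (y_0y_1, y_2) = q into 1 and (x_1y_2, y_4) = 1
  -- into q⁻¹; in (x_2y_3, y_4) the factors cancel.
  refine ⟨q⁻¹, inv_ne_zero hq0, _, (hsat.scale ![1, 1, Units.mk0 q hq0, Units.mk0 q hq0, 1]).congr
    ?_ ?_⟩
  · intro i j k hij hjk
    fin_cases j <;> fin_cases k <;> simp at hjk <;> fin_cases i <;> simp at hij <;>
      simp [alphaP, hq0]
  · intro i j k hij hjk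
    fin_cases j <;> fin_cases k <;> simp at hjk <;> fin_cases i <;> simp at hij <;>
      simp [betaP, hq0]

end chain

open Module

/-! ### The structure of the algebras in the family. -/

section family

variable {F L : Type*} [Field F] [AddCommGroup L] [Module F L]

/-- A subspace `V` of dimension one more than `W ≤ V` is spanned by `W` and any `e ∈ V \ W`. -/
theorem exists_smul_sub_mem [FiniteDimensional F L] {W V : Submodule F L} (hWV : W ≤ V)
    (hd : finrank F V ≤ finrank F W + 1) {e : L} (he : e ∈ V) (heW : e ∉ W) {v : L} (hv : v ∈ V) :
    ∃ c : F, v - c • e ∈ W := by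
  have hle : W ⊔ F ∙ e ≤ V := sup_le hWV ((Submodule.span_singleton_le_iff_mem _ _).2 he)
  have hlt : W < W ⊔ F ∙ e := by
    refine lt_of_le_of_ne le_sup_left fun h => heW ?_
    rw [h]
    exact Submodule.mem_sup_right (Submodule.mem_span_singleton_self e)
  have heq : W ⊔ F ∙ e = V :=
    Submodule.eq_of_le_of_finrank_le hle (by have := Submodule.finrank_lt_finrank_of_lt hlt; omega)
  rw [← heq, Submodule.mem_sup] at hv
  obtain ⟨w, hw, z, hz, rfl⟩ := hv
  obtain ⟨c, rfl⟩ := Submodule.mem_span_singleton.1 hz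
  exact ⟨c, by simpa using hw⟩

theorem exists_mem_notMem [FiniteDimensional F L] {W V : Submodule F L}
    (hd : finrank F W < finrank F V) : ∃ v ∈ V, v ∉ W := by
  by_contra! h
  exact absurd (Submodule.finrank_mono (show V ≤ W from h)) (by omega)

/-- A subspace of codimension two is complemented by any two vectors independent modulo it. -/
theorem exists_smul_smul_sub_mem [FiniteDimensional F L] {W : Submodule F L}
    (hd : finrank F L ≤ finrank F W + 2) {a c : L} (ha : a ∉ W) (hc : c ∉ W ⊔ F ∙ a) (v : L) :
    ∃ s t : F, v - s • a - t • c ∈ W := by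
  have hlt : W < W ⊔ F ∙ a := by
    refine lt_of_le_of_ne le_sup_left fun h => ha ?_
    rw [h]
    exact Submodule.mem_sup_right (Submodule.mem_span_singleton_self a)
  have := Submodule.finrank_lt_finrank_of_lt hlt
  obtain ⟨t, ht⟩ := exists_smul_sub_mem (le_top : W ⊔ F ∙ a ≤ ⊤) (by rw [finrank_top]; omega)
    trivial hc (v := v) trivial
  rw [Submodule.mem_sup] at ht
  obtain ⟨w, hw, z, hz, h⟩ := ht
  obtain ⟨s, rfl⟩ := Submodule.mem_span_singleton.1 hz
  refine ⟨s, t, ?_⟩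
  rwa [sub_right_comm, ← h, add_sub_cancel_right]

variable {S : SAA F L}

theorem mem_center_iff_tri {u : L} : u ∈ S.center ↔ ∀ v w, S.tri u v w = 0 := by
  rw [center, LinearMap.mem_ker]
  constructor
  · intro h v w
    simp [tri, h]
  · intro h
    ext v
    exact S.eq_zero_of_form_left (h v)

theorem mul_eq_zero_of_tri {u v : L} (h : ∀ w, S.tri u v w = 0) : S.mul u v = 0 :=
  S.eq_zero_of_form_left h

theorem mem_orthogonal {W : Submodule F L} {u : L} :
    u ∈ S.form.orthogonal W ↔ ∀ v ∈ W, S.form u v = 0 := by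
  rw [LinearMap.BilinForm.mem_orthogonal_iff]
  refine forall₂_congr fun v _ => ?_
  rw [S.form_swap, neg_eq_zero]

theorem mul_mem_power_succ' {k : ℕ} (hk : 1 ≤ k) {u : L} (hu : u ∈ S.power k) (v : L) :
    S.mul v u ∈ S.power (k + 1) := by
  rw [S.mul_swap]
  exact Submodule.neg_mem _ (S.mul_mem_power_succ hk hu v)

namespace InFamily

theorem finiteDimensional (h : S.InFamily) : FiniteDimensional F L :=
  Module.finite_of_finrank_pos (by rw [h.finrank_eq]; norm_num)

theorem power_eight (h : S.InFamily) : S.power 8 = ⊥ := h.nilpotent.1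

theorem power_seven (h : S.InFamily) : S.power 7 ≠ ⊥ := fun h7 => by
  have : 7 ≤ 6 := h.nilpotent.2 (show S.power (6 + 1) = ⊥ from h7)
  omega

/-- From (ab, v) = -(a, bv) a factor can be moved from the left argument to the right one, until the
right one lies in L^8 = 0. -/
theorem form_power (h : S.InFamily) {i j : ℕ} (hi : 1 ≤ i) (hj : 1 ≤ j) (hij : 9 ≤ i + j)
    {u v : L} (hu : u ∈ S.power i) (hv : v ∈ S.power j) : S.form u v = 0 := by
  have key : ∀ i, 1 ≤ i → ∀ j, 1 ≤ j → i + j = 9 → ∀ u ∈ S.power i, ∀ v ∈ S.power j,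
      S.form u v = 0 := by
    intro i hi
    induction i, hi using Nat.le_induction with
    | base =>
      intro j _ hj u _ v hv
      obtain rfl : j = 8 := by omega
      rw [h.power_eight, Submodule.mem_bot] at hv
      simp [hv]
    | succ i hi ih =>
      intro j hj hij u hu v hv
      have : S.power (i + 1) ≤ LinearMap.ker (LinearMap.flip S.form v) := by
        rw [S.power_succ hi, S.prod_le]
        intro a ha b _
        rw [LinearMap.mem_ker, LinearMap.flip_apply, ← tri_def, tri_cycle, tri_def, S.form_swap,
          ih (j + 1) (by omega) (by omega) a ha _ (mul_mem_power_succ' hj hv b), neg_zero]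
      exact this hu
  rcases le_or_gt 8 i with hi8 | hi8
  · have := S.power_antitone hi8 hu
    rw [h.power_eight, Submodule.mem_bot] at this
    simp [this]
  · exact key i hi (9 - i) (by omega) (by omega) u hu v (S.power_antitone (by omega) hv)

theorem tri_power (h : S.InFamily) {i j : ℕ} (hi : 1 ≤ i) (hj : 1 ≤ j) (hij : 8 ≤ i + j)
    {u v : L} (hu : u ∈ S.power i) (hv : v ∈ S.power j) (w : L) : S.tri u v w = 0 := by
  rw [← tri_cycle, tri_def]
  exact h.form_power (by omega) hj (by omega) (mul_mem_power_succ' hi hu w) hv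

theorem center_eq_orthogonal : S.center = S.form.orthogonal (S.power 2) := by
  ext u
  rw [mem_center_iff_tri, mem_orthogonal]
  have h2 : S.power 2 = S.prod ⊤ ⊤ := rfl
  constructor
  · intro hu v hv
    have : S.power 2 ≤ LinearMap.ker (S.form u) := by
      rw [h2, S.prod_le]
      intro a _ b _
      rw [LinearMap.mem_ker, S.form_swap, ← tri_def, ← tri_cycle, hu, neg_zero]
    exact this hv
  · intro hu v w
    rw [tri_cycle, tri_def, S.form_swap, hu _ (S.mul_mem_prod trivial trivial), neg_zero]

theorem finrank_orthogonal (h : S.InFamily) (W : Submodule F L) :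
    finrank F (S.form.orthogonal W) + finrank F W = 10 := by
  have := h.finiteDimensional
  have h1 := LinearMap.BilinForm.finrank_orthogonal S.form_nondegenerate W
  have h2 := Submodule.finrank_le W
  rw [h.finrank_eq] at h1 h2
  omega

theorem finrank_two (h : S.InFamily) : finrank F (S.power 2) = 8 := by
  have h1 := h.finrank_orthogonal (S.power 2)
  rw [← center_eq_orthogonal, h.finrank_center] at h1
  omega

theorem finrank_succ_lt (h : S.InFamily) {k m : ℕ} (hm : k + 1 = m) (hk : 1 ≤ k) (hk7 : k ≤ 7) :
    finrank F (S.power m) < finrank F (S.power k) := by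
  subst hm
  have := h.finiteDimensional
  refine Submodule.finrank_lt_finrank_of_lt (lt_of_le_of_ne (S.power_antitone (by omega))
    fun heq => h.power_seven ?_)
  have h7 := S.power_eq_of_succ_eq hk heq (7 - k)
  have h8 := S.power_eq_of_succ_eq hk heq (8 - k)
  rw [Nat.add_sub_cancel' (by omega)] at h7 h8
  rw [h7, ← h8, h.power_eight]

/-- An element orthogonal to the third power is central if it is orthogonal to one product
of two elements spanning modulo the second power. -/
theorem mem_center_of_tri (h : S.InFamily) {a c : L} (ha : a ∉ S.power 2)
    (hc : c ∉ S.power 2 ⊔ F ∙ a) {u : L} (hu : ∀ v ∈ S.power 3, S.form u v = 0)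
    (ht : S.tri u a c = 0) : u ∈ S.center := by
  have := h.finiteDimensional
  have h2 : ∀ p ∈ S.power 2, ∀ w, S.tri u p w = 0 := fun p hp w => by
    rw [tri_cycle, tri_def, S.form_swap, hu _ (S.mul_mem_power_succ (by norm_num) hp w), neg_zero]
  have h2' : ∀ p ∈ S.power 2, ∀ w, S.tri u w p = 0 := fun p hp w => by
    rw [tri_swap_right, h2 p hp, neg_zero]
  rw [mem_center_iff_tri]
  intro v w
  have hd : finrank F L ≤ finrank F (S.power 2) + 2 := by rw [h.finrank_eq, h.finrank_two]
  obtain ⟨s, t, hv⟩ := exists_smul_smul_sub_mem hd ha hc v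
  obtain ⟨s', t', hw⟩ := exists_smul_smul_sub_mem hd ha hc w
  have ev : v = (v - s • a - t • c) + (s • a + t • c) := by abel
  have ew : w = (w - s' • a - t' • c) + (s' • a + t' • c) := by abel
  rw [ev, ew]
  simp only [tri_add_mid, tri_add_right, h2 _ hv, h2' _ hw, tri_smul_mid, tri_smul_right, ht,
    tri_self_right, S.tri_swap_right u c a]
  ring

/-- There are two vectors spanning modulo the second power. -/
theorem exists_generators (h : S.InFamily) : ∃ a c, a ∉ S.power 2 ∧ c ∉ S.power 2 ⊔ F ∙ a := by
  have := h.finiteDimensional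
  obtain ⟨a, -, ha⟩ := exists_mem_notMem (W := S.power 2) (V := ⊤)
    (by rw [finrank_top, h.finrank_eq, h.finrank_two]; norm_num)
  obtain ⟨c, -, hc⟩ := exists_mem_notMem (W := S.power 2 ⊔ F ∙ a) (V := ⊤) (by
    have h1 := Submodule.finrank_add_le_finrank_add_finrank (S.power 2) (F ∙ a)
    have h2 := finrank_span_le_card (R := F) ({a} : Set L)
    simp at h2
    rw [finrank_top, h.finrank_eq]
    rw [h.finrank_two] at h1
    omega)
  exact ⟨a, c, ha, hc⟩

/-- On (L^3)^⊥ the functional u ↦ (ua, c) has kernel inside the centre by `mem_center_of_tri`, so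
(L^3)^⊥ has dimension at most 3; strict descent from L^2 gives the other bound. -/
theorem finrank_three (h : S.InFamily) : finrank F (S.power 3) = 7 := by
  have := h.finiteDimensional
  obtain ⟨a, c, ha, hc⟩ := h.exists_generators
  have h23 := h.finrank_succ_lt (k := 2) (m := 3) rfl (by norm_num) (by norm_num)
  have h3 := h.finrank_orthogonal (S.power 3)
  have hZ := h.finrank_center
  have hle : finrank F (S.form.orthogonal (S.power 3)) ≤ 3 := by
    by_cases hZ2 : S.form.orthogonal (S.power 3) ≤ S.center
    · have := Submodule.finrank_mono hZ2
      omega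
    · obtain ⟨u, hu, huZ⟩ := SetLike.not_le_iff_exists.1 hZ2
      have ht : S.tri u a c ≠ 0 := fun ht =>
        huZ (h.mem_center_of_tri ha hc (mem_orthogonal.1 hu) ht)
      have hsup : S.form.orthogonal (S.power 3) ≤ S.center ⊔ F ∙ u := by
        intro v hv
        have hvu : v - (S.tri v a c / S.tri u a c) • u ∈ S.center := by
          refine h.mem_center_of_tri ha hc (mem_orthogonal.1 (Submodule.sub_mem _ hv
            (Submodule.smul_mem _ _ hu))) ?_
          rw [tri_sub_left, tri_smul_left, div_mul_cancel₀ _ ht, sub_self]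
        rw [Submodule.mem_sup]
        exact ⟨_, hvu, _, Submodule.smul_mem _ _ (Submodule.mem_span_singleton_self u),
          sub_add_cancel _ _⟩
      have h1 := Submodule.finrank_mono hsup
      have h2 := Submodule.finrank_add_le_finrank_add_finrank S.center (F ∙ u)
      have h4 := finrank_span_le_card (R := F) ({u} : Set L)
      simp at h4
      omega
  rw [h.finrank_two] at h23
  omega

theorem power_le_orthogonal (h : S.InFamily) {i j : ℕ} (hi : 1 ≤ i) (hj : 1 ≤ j)
    (hij : 9 ≤ i + j) : S.power i ≤ S.form.orthogonal (S.power j) := fun _ hu =>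
  mem_orthogonal.2 fun _ hv => h.form_power hi hj hij hu hv

/-- L^6 is not central, since L^7 ≠ 0. For a non-central u ∈ L^6 the value (ua, c) is non-zero,
which makes ua and uc independent in L^7; and L^7 lies in the two-dimensional centre. -/
theorem finrank_seven (h : S.InFamily) : finrank F (S.power 7) = 2 := by
  have := h.finiteDimensional
  have hle : finrank F (S.power 7) ≤ 2 := by
    have h1 := h.power_le_orthogonal (i := 7) (j := 2) (by norm_num) (by norm_num) (by norm_num)
    rw [← center_eq_orthogonal] at h1
    exact (Submodule.finrank_mono h1).trans h.finrank_center.le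
  have hpos := h.finrank_succ_lt (k := 7) (m := 8) rfl (by norm_num) (by norm_num)
  obtain ⟨u, hu, huZ⟩ : ∃ u ∈ S.power 6, u ∉ S.center := by
    by_contra! h6
    apply h.power_seven
    rw [S.power_succ (by norm_num), eq_bot_iff, S.prod_le]
    intro a ha b _
    have : S.mul a = 0 := h6 a ha
    simp [this]
  obtain ⟨a, c, ha, hc⟩ := h.exists_generators
  have ht : S.tri u a c ≠ 0 := fun ht => huZ (h.mem_center_of_tri ha hc
    (fun v hv => h.form_power (by norm_num) (by norm_num) (by norm_num) hu hv) ht)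
  by_contra hne
  have ha0 : S.mul u a ∉ (⊥ : Submodule F L) := fun h0 => ht (by
    rw [Submodule.mem_bot] at h0
    simp [tri, h0])
  obtain ⟨d, hd⟩ := exists_smul_sub_mem (bot_le : ⊥ ≤ S.power 7)
    (by rw [finrank_bot]; omega) (S.mul_mem_power_succ (by norm_num) hu a) ha0
    (S.mul_mem_power_succ (by norm_num) hu c)
  rw [Submodule.mem_bot, sub_eq_zero] at hd
  have h1 : d * S.tri u a c = 0 := by
    rw [tri_def, ← smul_eq_mul, ← LinearMap.smul_apply, ← map_smul, ← hd, ← tri_def, tri_self_right]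
  have hd0 : d = 0 := (mul_eq_zero.1 h1).resolve_right ht
  rw [hd0, zero_smul] at hd
  apply ht
  rw [tri_swap_right, tri_def, hd]
  simp

theorem finrank_six (h : S.InFamily) : finrank F (S.power 6) = 3 := by
  have := h.finiteDimensional
  have h1 := Submodule.finrank_mono
    (h.power_le_orthogonal (i := 6) (j := 3) (by norm_num) (by norm_num) (by norm_num))
  have h2 := h.finrank_orthogonal (S.power 3)
  have h3 := h.finrank_succ_lt (k := 6) (m := 7) rfl (by norm_num) (by norm_num)
  rw [h.finrank_three] at h2
  rw [h.finrank_seven] at h3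
  omega

/-- Orthogonality and strict descent leave only dim L^4 = 5 to be excluded. In that case L^5 would
be a hyperplane of L^4 orthogonal to L^4, making L^4 isotropic; then (L^4L, L^3) = 0 would place the
four-dimensional L^5 inside the three-dimensional (L^3)^⊥. -/
theorem finrank_four_five (h : S.InFamily) :
    finrank F (S.power 4) = 6 ∧ finrank F (S.power 5) = 4 := by
  have := h.finiteDimensional
  have h1 := Submodule.finrank_mono
    (h.power_le_orthogonal (i := 5) (j := 4) (by norm_num) (by norm_num) (by norm_num))
  have h2 := h.finrank_orthogonal (S.power 4)
  have h3 := h.finrank_succ_lt (k := 5) (m := 6) rfl (by norm_num) (by norm_num)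
  have h4 := h.finrank_succ_lt (k := 4) (m := 5) rfl (by norm_num) (by norm_num)
  have h5 := h.finrank_succ_lt (k := 3) (m := 4) rfl (by norm_num) (by norm_num)
  rw [h.finrank_three] at h5
  rw [h.finrank_six] at h3
  suffices finrank F (S.power 4) ≠ 5 by omega
  intro h45
  obtain ⟨e, he, he5⟩ := exists_mem_notMem (W := S.power 5) (V := S.power 4) (by omega)
  have hiso : ∀ u ∈ S.power 4, ∀ v ∈ S.power 4, S.form u v = 0 := by
    intro u hu v hv
    have h54 : S.power 5 ≤ S.power 4 := S.power_antitone (by norm_num)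
    obtain ⟨c, hc⟩ := exists_smul_sub_mem h54 (by omega) he he5 hu
    obtain ⟨d, hd⟩ := exists_smul_sub_mem h54 (by omega) he he5 hv
    have e1 : S.form (u - c • e) v = 0 :=
      h.form_power (by norm_num) (by norm_num) (by norm_num) hc hv
    have e2 : S.form e (v - d • e) = 0 :=
      h.form_power (by norm_num) (by norm_num) (by norm_num) he hd
    simp only [map_sub, map_smul, LinearMap.sub_apply, LinearMap.smul_apply, S.form_self, smul_zero,
      sub_zero] at e1 e2
    rw [e2, smul_zero, sub_zero] at e1
    exact e1
  have h53 : S.power 5 ≤ S.form.orthogonal (S.power 3) := by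
    rw [S.power_succ (k := 4) (by norm_num), S.prod_le]
    intro a ha b _
    rw [mem_orthogonal]
    intro p hp
    rw [← tri_def, tri_cycle, tri_def]
    exact hiso _ (mul_mem_power_succ' (by norm_num) hp b) a ha
  have h6 := Submodule.finrank_mono h53
  have h7 := h.finrank_orthogonal (S.power 3)
  rw [h.finrank_three] at h7
  omega

/-- The inclusion of L^i in (L^j)^⊥ is an equality because the dimensions found above are
complementary. -/
theorem mem_power_iff (h : S.InFamily) {i j : ℕ} (hi : 2 ≤ i) (hi7 : i ≤ 7) (hij : i + j = 9)
    {u : L} : u ∈ S.power i ↔ ∀ v ∈ S.power j, S.form u v = 0 := by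
  have := h.finiteDimensional
  rw [← mem_orthogonal]
  suffices S.power i = S.form.orthogonal (S.power j) by rw [this]
  refine Submodule.eq_of_le_of_finrank_le
    (h.power_le_orthogonal (by omega) (by omega) (by omega)) ?_
  have h0 := h.finrank_orthogonal (S.power j)
  have h2 := h.finrank_two
  have h3 := h.finrank_three
  have h4 := h.finrank_four_five
  have h6 := h.finrank_six
  have h7 := h.finrank_seven
  interval_cases i
  · obtain rfl : j = 7 := by omega
    omega
  · obtain rfl : j = 6 := by omega
    omega
  · obtain rfl : j = 5 := by omega
    omega
  · obtain rfl : j = 4 := by omega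
    omega
  · obtain rfl : j = 3 := by omega
    omega
  · obtain rfl : j = 2 := by omega
    omega

theorem mem_power_seven_iff (h : S.InFamily) {u : L} :
    u ∈ S.power 7 ↔ ∀ v w, S.tri u v w = 0 := by
  rw [h.mem_power_iff (by norm_num) le_rfl (j := 2) (by norm_num), ← mem_orthogonal,
    ← center_eq_orthogonal, mem_center_iff_tri]

theorem exists_smul_sub_mem_power (h : S.InFamily) {k m : ℕ} (hkm : k ≤ m)
    (hd : finrank F (S.power k) ≤ finrank F (S.power m) + 1) {e : L} (he : e ∈ S.power k)
    (hem : e ∉ S.power m) {v : L} (hv : v ∈ S.power k) : ∃ c : F, v - c • e ∈ S.power m :=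
  have := h.finiteDimensional
  exists_smul_sub_mem (S.power_antitone hkm) hd he hem hv

/-! ### Products of powers, the line L^5L^2 and the ideal U. -/

theorem mul_power (h : S.InFamily) {i j : ℕ} (hi : 1 ≤ i) (hj : 1 ≤ j) (hij : 8 ≤ i + j)
    {u v : L} (hu : u ∈ S.power i) (hv : v ∈ S.power j) : S.mul u v = 0 :=
  mul_eq_zero_of_tri (h.tri_power hi hj hij hu hv)

/-- For fixed u ∈ L^5 the alternating form (uv, p) on L^2 vanishes when an argument lies in L^3;
since L^2/L^3 is a line it is zero, so uL^2 ≤ (L^2)^⊥ = L^7. -/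
theorem mul_mem_seven (h : S.InFamily) {u v : L} (hu : u ∈ S.power 5) (hv : v ∈ S.power 2) :
    S.mul u v ∈ S.power 7 := by
  have := h.finiteDimensional
  obtain ⟨g, hg, hg3⟩ := exists_mem_notMem (W := S.power 3) (V := S.power 2)
    (by rw [h.finrank_two, h.finrank_three]; norm_num)
  have hd : finrank F (S.power 2) ≤ finrank F (S.power 3) + 1 := by
    rw [h.finrank_two, h.finrank_three]
  rw [h.mem_power_iff (by norm_num) le_rfl (j := 2) rfl]
  intro p hp
  obtain ⟨c, hc⟩ := h.exists_smul_sub_mem_power (by norm_num) hd hg hg3 hv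
  obtain ⟨d, hd⟩ := h.exists_smul_sub_mem_power (by norm_num) hd hg hg3 hp
  have e1 := h.tri_power (by norm_num) (by norm_num) (by norm_num) hu hc p
  have e2 := h.tri_power (by norm_num) (by norm_num) (by norm_num) hu hd g
  rw [tri_sub_mid, tri_smul_mid] at e1
  rw [tri_sub_mid, tri_smul_mid, tri_self_right, mul_zero, sub_zero, tri_swap_right,
    neg_eq_zero] at e2
  rw [e2, mul_zero, sub_zero] at e1
  exact e1

/-- Otherwise uL^2 = 0, so uL ≤ (L^2)^⊥ = L^7. As u spans L^5 modulo L^6, this would give L^6 = L^5L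
≤ L^7. -/
theorem mul_ne_zero_five_two (h : S.InFamily) {u v : L} (hu : u ∈ S.power 5)
    (hu6 : u ∉ S.power 6) (hv : v ∈ S.power 2) (hv3 : v ∉ S.power 3) : S.mul u v ≠ 0 := by
  intro h0
  have := h.finiteDimensional
  have hp : ∀ p ∈ S.power 2, S.mul u p = 0 := by
    intro p hp
    obtain ⟨c, hc⟩ := h.exists_smul_sub_mem_power (by norm_num)
      (by rw [h.finrank_two, h.finrank_three]) hv hv3 hp
    have := h.mul_power (by norm_num) (by norm_num) (by norm_num) hu hc
    rwa [map_sub, map_smul, h0, smul_zero, sub_zero] at this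
  have huL : ∀ w, S.mul u w ∈ S.power 7 := by
    intro w
    rw [h.mem_power_iff (by norm_num) le_rfl (j := 2) rfl]
    intro p hp2
    rw [← tri_def, tri_swap_right, tri_def, hp p hp2]
    simp
  have h67 : S.power 6 ≤ S.power 7 := by
    rw [S.power_succ (k := 5) (by norm_num), S.prod_le]
    intro a ha b _
    obtain ⟨c, hc⟩ := h.exists_smul_sub_mem_power (by norm_num)
      (by rw [h.finrank_six, h.finrank_four_five.2]) hu hu6 ha
    have e : S.mul a b = S.mul (a - c • u) b + c • S.mul u b := by simp
    rw [e]
    exact add_mem (S.mul_mem_power_succ (by norm_num) hc b) (Submodule.smul_mem _ _ (huL b))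
  have := Submodule.finrank_mono h67
  rw [h.finrank_six, h.finrank_seven] at this
  omega

/-- Both L^5/L^6 and L^2/L^3 are lines, and L^6L^2 = L^5L^3 = 0, so a single product generates. -/
theorem exists_span_prod_five_two (h : S.InFamily) :
    ∃ j, j ≠ 0 ∧ j ∈ S.power 7 ∧ S.prod (S.power 5) (S.power 2) = F ∙ j := by
  have := h.finiteDimensional
  obtain ⟨g, hg, hg3⟩ := exists_mem_notMem (W := S.power 3) (V := S.power 2)
    (by rw [h.finrank_two, h.finrank_three]; norm_num)
  obtain ⟨e, he, he6⟩ := exists_mem_notMem (W := S.power 6) (V := S.power 5)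
    (by rw [h.finrank_six, h.finrank_four_five.2]; norm_num)
  refine ⟨S.mul e g, h.mul_ne_zero_five_two he he6 hg hg3, h.mul_mem_seven he hg,
    le_antisymm (S.prod_le.2 fun u hu v hv => ?_)
      ((Submodule.span_singleton_le_iff_mem _ _).2 (S.mul_mem_prod he hg))⟩
  obtain ⟨c, hc⟩ := h.exists_smul_sub_mem_power (by norm_num)
    (by rw [h.finrank_two, h.finrank_three]) hg hg3 hv
  obtain ⟨d, hd⟩ := h.exists_smul_sub_mem_power (by norm_num)
    (by rw [h.finrank_six, h.finrank_four_five.2]) he he6 hu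
  have e1 := h.mul_power (by norm_num) (by norm_num) (by norm_num) hu hc
  have e2 := h.mul_power (by norm_num) (by norm_num) (by norm_num) hd hg
  rw [map_sub, map_smul, sub_eq_zero] at e1
  rw [map_sub, map_smul, LinearMap.sub_apply, LinearMap.smul_apply, sub_eq_zero] at e2
  rw [e1, e2]
  exact Submodule.smul_mem _ _ (Submodule.smul_mem _ _ (Submodule.mem_span_singleton_self _))

theorem firstMeeting_eq (h : S.InFamily) :
    S.firstMeeting = S.prod (S.power 5) (S.power 2) := by
  obtain ⟨j, hj, -, hJ⟩ := h.exists_span_prod_five_two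
  rw [firstMeeting, if_pos]
  rw [inf_eq_left.2 h.prod52_le, hJ]
  simpa using hj

theorem mem_idealU (h : S.InFamily) {u : L} : u ∈ S.idealU ↔
    u ∈ S.power 4 ∧ ∀ v ∈ S.power 3, S.mul u v ∈ S.prod (S.power 5) (S.power 2) := by
  rw [idealU, mem_transporter, h.firstMeeting_eq]

theorem power_five_le_idealU (h : S.InFamily) : S.power 5 ≤ S.idealU := fun u hu =>
  h.mem_idealU.2 ⟨S.power_antitone (by norm_num) hu, fun v hv => by
    rw [h.mul_power (by norm_num) (by norm_num) (by norm_num) hu hv]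
    exact zero_mem _⟩

theorem prod_idealU_two (h : S.InFamily) :
    S.prod S.idealU (S.power 2) = S.prod (S.power 5) (S.power 2) := by
  have := h.finiteDimensional
  obtain ⟨j, hj, -, hJ⟩ := h.exists_span_prod_five_two
  refine (Submodule.eq_of_le_of_finrank_le (S.prod_mono h.power_five_le_idealU le_rfl) ?_).symm
  rw [h.finrank_U, hJ, finrank_span_singleton hj]

/-- Otherwise uL^3 = 0, which makes u orthogonal to L^3L = L^4 and hence an element of L^5. -/
theorem mul_ne_zero_four_three (h : S.InFamily) {u v : L} (hu : u ∈ S.power 4)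
    (hu5 : u ∉ S.power 5) (hv : v ∈ S.power 3) (hv4 : v ∉ S.power 4) : S.mul u v ≠ 0 := by
  intro h0
  have hp : ∀ p ∈ S.power 3, S.mul u p = 0 := by
    intro p hp
    obtain ⟨c, hc⟩ := h.exists_smul_sub_mem_power (by norm_num)
      (by rw [h.finrank_four_five.1, h.finrank_three]) hv hv4 hp
    have := h.mul_power (by norm_num) (by norm_num) (by norm_num) hu hc
    rwa [map_sub, map_smul, h0, smul_zero, sub_zero] at this
  apply hu5
  rw [h.mem_power_iff (by norm_num) (by norm_num) (j := 4) rfl]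
  have : S.power 4 ≤ LinearMap.ker (S.form u) := by
    rw [S.power_succ (k := 3) (by norm_num), S.prod_le]
    intro a ha b _
    rw [LinearMap.mem_ker, S.form_swap, ← tri_def, ← tri_cycle, tri_def, hp a ha]
    simp
  exact fun p hp => this hp

/-- The subspace `U` is spanned by one element modulo the fifth power. -/
theorem exists_idealU_generator (h : S.InFamily) :
    ∃ e ∈ S.idealU, e ∉ S.power 5 ∧ ∀ u ∈ S.idealU, ∃ c : F, u - c • e ∈ S.power 5 := by
  have := h.finiteDimensional
  obtain ⟨j, hj, -, hJ⟩ := h.exists_span_prod_five_two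
  obtain ⟨g, hg, hg4⟩ := exists_mem_notMem (W := S.power 4) (V := S.power 3)
    (by rw [h.finrank_four_five.1, h.finrank_three]; norm_num)
  -- Since L^4L^4 = 0 and L^3/L^4 is a line, L^3 acts on L^4 through multiples of g. Thus U is the
  -- preimage of J under u ↦ ug on L^4, whose kernel is L^5, and J is attained because L^5L^2 ≤
  -- L^4L^3.
  have hg' : ∀ v ∈ S.power 3, ∃ c : F, ∀ u ∈ S.power 4, S.mul u v = c • S.mul u g := by
    intro v hv
    obtain ⟨c, hc⟩ := h.exists_smul_sub_mem_power (by norm_num)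
      (by rw [h.finrank_four_five.1, h.finrank_three]) hg hg4 hv
    refine ⟨c, fun u hu => ?_⟩
    have := h.mul_power (by norm_num) (by norm_num) (by norm_num) hu hc
    rwa [map_sub, map_smul, sub_eq_zero] at this
  have hK : S.prod (S.power 4) (S.power 3) ≤ (S.power 4).map (LinearMap.flip S.mul g) := by
    rw [S.prod_le]
    intro u hu v hv
    obtain ⟨c, hc⟩ := hg' v hv
    exact ⟨c • u, Submodule.smul_mem _ _ hu, by simp [hc u hu]⟩
  have hjJ : j ∈ S.prod (S.power 5) (S.power 2) := by
    rw [hJ]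
    exact Submodule.mem_span_singleton_self j
  obtain ⟨e, he, hej⟩ := hK (h.prod52_le hjJ)
  rw [LinearMap.flip_apply] at hej
  refine ⟨e, h.mem_idealU.2 ⟨he, fun v hv => ?_⟩, fun he5 => ?_, fun u hu => ?_⟩
  · obtain ⟨c, hc⟩ := hg' v hv
    rw [hc e he, hej]
    exact Submodule.smul_mem _ _ hjJ
  · rw [h.mul_power (by norm_num) (by norm_num) (by norm_num) he5 hg] at hej
    exact hj hej.symm
  · obtain ⟨hu4, hu⟩ := h.mem_idealU.1 hu
    have := hu g hg
    rw [hJ, Submodule.mem_span_singleton] at this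
    obtain ⟨c, hc⟩ := this
    refine ⟨c, ?_⟩
    by_contra h5
    refine h.mul_ne_zero_four_three (Submodule.sub_mem _ hu4 (Submodule.smul_mem _ c he)) h5 hg hg4
      ?_
    simp [hej, hc]

/-- U is L^5 together with one further vector e, while L^5L^4 = 0 and ee = 0. -/
theorem idealU_mul_idealU (h : S.InFamily) {u v : L} (hu : u ∈ S.idealU) (hv : v ∈ S.idealU)
    (w : L) : S.tri u v w = 0 := by
  obtain ⟨e, he, -, hgen⟩ := h.exists_idealU_generator
  obtain ⟨c, hc⟩ := hgen u hu
  obtain ⟨d, hd⟩ := hgen v hv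
  have e1 := h.tri_power (by norm_num) (by norm_num) (by norm_num) hc (h.mem_idealU.1 hv).1 w
  have e2 := h.tri_power (by norm_num) (by norm_num) (by norm_num) (h.mem_idealU.1 he).1 hd w
  rw [tri_sub_left, tri_smul_left] at e1
  rw [tri_sub_mid, tri_smul_mid, tri_self_left, mul_zero, sub_zero] at e2
  rwa [e2, mul_zero, sub_zero] at e1

theorem idealU_isotropic (h : S.InFamily) : S.IsIsotropic S.idealU := by
  intro u hu v hv
  obtain ⟨e, he, -, hgen⟩ := h.exists_idealU_generator
  obtain ⟨c, hc⟩ := hgen u hu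
  obtain ⟨d, hd⟩ := hgen v hv
  have e1 := h.form_power (by norm_num) (by norm_num) (by norm_num) hc (h.mem_idealU.1 hv).1
  have e2 := h.form_power (by norm_num) (by norm_num) (by norm_num) (h.mem_idealU.1 he).1 hd
  simp only [map_sub, map_smul, LinearMap.sub_apply, LinearMap.smul_apply, S.form_self, smul_zero,
    sub_zero] at e1 e2
  rwa [e2, smul_zero, sub_zero] at e1

/-- This is where L^4L^3 ≠ L^7 enters. If the value were zero, L^4L^3 would be orthogonal to L^2 and
so properly contained in the two-dimensional L^7. It would then equal the line L^5L^2, which forces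
f into U. -/
theorem tri_ne_zero (h : S.InFamily) {f g g' : L} (hf : f ∈ S.power 4) (hfU : f ∉ S.idealU)
    (hfgen : ∀ v ∈ S.power 4, ∃ c : F, v - c • f ∈ S.idealU)
    (hg : g ∈ S.power 3) (hg4 : g ∉ S.power 4) (hg' : g' ∈ S.power 2) (hg'3 : g' ∉ S.power 3) :
    S.tri f g g' ≠ 0 := by
  intro h0
  have := h.finiteDimensional
  obtain ⟨j, hj, hj7, hJ⟩ := h.exists_span_prod_five_two
  have h34 : ∀ v ∈ S.power 3, ∃ c : F, v - c • g ∈ S.power 4 := fun v hv =>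
    h.exists_smul_sub_mem_power (by norm_num) (by rw [h.finrank_four_five.1, h.finrank_three])
      hg hg4 hv
  have hag : ∀ a ∈ S.power 4, ∀ p ∈ S.power 2, S.tri a g p = 0 := by
    intro a ha p hp
    have ha3 : ∀ q ∈ S.power 3, S.tri a g q = 0 := by
      intro q hq
      obtain ⟨c, hc⟩ := h34 q hq
      have := h.tri_power (by norm_num) (by norm_num) (by norm_num) ha hc g
      rwa [tri_swap_right, tri_sub_right, tri_smul_right, tri_self_right, mul_zero, sub_zero,
        neg_eq_zero] at this
    obtain ⟨c, hc⟩ := h.exists_smul_sub_mem_power (by norm_num)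
      (by rw [h.finrank_two, h.finrank_three]) hg' hg'3 hp
    obtain ⟨d, hd⟩ := hfgen a ha
    have e1 := ha3 _ hc
    have e2 : S.tri (a - d • f) g g' = 0 := by
      have := (h.mem_idealU.1 hd).2 g hg
      rw [hJ] at this
      obtain ⟨k, hk⟩ := Submodule.mem_span_singleton.1 this
      rw [tri_def, ← hk, map_smul, LinearMap.smul_apply,
        h.form_power (by norm_num) (by norm_num) (by norm_num) hj7 hg', smul_zero]
    rw [tri_sub_left, tri_smul_left, h0, mul_zero, sub_zero] at e2
    rwa [tri_sub_right, tri_smul_right, e2, mul_zero, sub_zero] at e1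
  have hK7 : S.prod (S.power 4) (S.power 3) ≤ S.power 7 := by
    rw [S.prod_le]
    intro a ha b hb
    rw [h.mem_power_iff (by norm_num) le_rfl (j := 2) rfl]
    intro p hp
    obtain ⟨c, hc⟩ := h34 b hb
    have := h.tri_power (by norm_num) (by norm_num) (by norm_num) ha hc p
    rwa [tri_sub_mid, tri_smul_mid, hag a ha p hp, mul_zero, sub_zero] at this
  have hlt := Submodule.finrank_lt_finrank_of_lt (lt_of_le_of_ne hK7 h.prod43_ne)
  rw [h.finrank_seven] at hlt
  have heq : S.prod (S.power 5) (S.power 2) = S.prod (S.power 4) (S.power 3) := by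
    refine Submodule.eq_of_le_of_finrank_le h.prod52_le ?_
    rw [hJ, finrank_span_singleton hj]
    omega
  refine hfU (h.mem_idealU.2 ⟨hf, fun v hv => ?_⟩)
  rw [heq]
  exact S.mul_mem_prod hf hv

/-- Vectors exhibiting the structure of an algebra of the family. -/
theorem exists_frame (h : S.InFamily) : ∃ j y k e f g g' : L,
    j ∈ S.power 7 ∧ S.prod (S.power 5) (S.power 2) = F ∙ j ∧ S.form j y = 1 ∧
    S.form j k = 0 ∧ k ∉ S.power 2 ∧
    (∀ v, S.form j v = 0 → ∃ c : F, v - c • k ∈ S.power 2) ∧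
    e ∈ S.idealU ∧ e ∉ S.power 5 ∧ (∀ u ∈ S.idealU, ∃ c : F, u - c • e ∈ S.power 5) ∧
    f ∈ S.power 4 ∧ f ∉ S.idealU ∧ (∀ v ∈ S.power 4, ∃ c : F, v - c • f ∈ S.idealU) ∧
    g ∈ S.power 3 ∧ g ∉ S.power 4 ∧ g' ∈ S.power 2 ∧ g' ∉ S.power 3 := by
  have := h.finiteDimensional
  obtain ⟨j, hj, hj7, hJ⟩ := h.exists_span_prod_five_two
  obtain ⟨y, hy⟩ : ∃ y, S.form j y ≠ 0 := by
    by_contra! h0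
    exact hj (S.eq_zero_of_form_left h0)
  have hj2 : ∀ p ∈ S.power 2, S.form j p = 0 := fun p hp =>
    h.form_power (by norm_num) (by norm_num) (by norm_num) hj7 hp
  obtain ⟨k, hk, hk2⟩ : ∃ k, S.form j k = 0 ∧ k ∉ S.power 2 := by
    obtain ⟨a, c, ha, hc⟩ := h.exists_generators
    by_cases hja : S.form j a = 0
    · exact ⟨a, hja, ha⟩
    · refine ⟨c - (S.form j c / S.form j a) • a, by simp [hja], fun hm => hc ?_⟩
      rw [Submodule.mem_sup]
      exact ⟨_, hm, _, Submodule.smul_mem _ _ (Submodule.mem_span_singleton_self a),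
        sub_add_cancel _ _⟩
  have hyk : y ∉ S.power 2 ⊔ F ∙ k := by
    intro hm
    obtain ⟨p, hp, z, hz, rfl⟩ := Submodule.mem_sup.1 hm
    obtain ⟨c, rfl⟩ := Submodule.mem_span_singleton.1 hz
    exact hy (by simp [hj2 p hp, hk])
  obtain ⟨e, he, he5, hgen⟩ := h.exists_idealU_generator
  have hU4 : S.idealU ≤ S.power 4 := fun u hu => (h.mem_idealU.1 hu).1
  have hU5 : finrank F (S.power 5) < finrank F S.idealU :=
    Submodule.finrank_lt_finrank_of_lt
      (lt_of_le_of_ne h.power_five_le_idealU fun heq => he5 (heq ▸ he))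
  -- If U were all of L^4, then L^4 would be isotropic and contained in (L^4)^⊥ = L^5.
  obtain ⟨f, hf, hfU⟩ : ∃ f ∈ S.power 4, f ∉ S.idealU := by
    by_contra! hle
    have h45 : S.power 4 ≤ S.power 5 := fun u hu =>
      (h.mem_power_iff (by norm_num) (by norm_num) (j := 4) rfl).2 fun v hv =>
        h.idealU_isotropic u (hle u hu) v (hle v hv)
    have := Submodule.finrank_mono h45
    rw [h.finrank_four_five.1, h.finrank_four_five.2] at this
    omega
  obtain ⟨g, hg, hg4⟩ := exists_mem_notMem (W := S.power 4) (V := S.power 3)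
    (by rw [h.finrank_four_five.1, h.finrank_three]; norm_num)
  obtain ⟨g', hg', hg'3⟩ := exists_mem_notMem (W := S.power 3) (V := S.power 2)
    (by rw [h.finrank_two, h.finrank_three]; norm_num)
  refine ⟨(S.form j y)⁻¹ • j, y, k, e, f, g, g', Submodule.smul_mem _ _ hj7, ?_, by simp [hy],
    by simp [hk], hk2, fun v hv => ?_, he, he5, hgen, hf, hfU, fun v hv => ?_, hg, hg4, hg', hg'3⟩
  · rw [hJ]
    exact (Submodule.span_singleton_smul_eq (IsUnit.mk0 _ (inv_ne_zero hy)) j).symm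
  · have hv0 : S.form j v = 0 := by simpa [hy] using hv
    obtain ⟨s, t, hst⟩ := exists_smul_smul_sub_mem
      (by rw [h.finrank_eq, h.finrank_two]) hk2 hyk v
    have ht : t = 0 := by
      have := hj2 _ hst
      simpa [hv0, hk, hy] using this
    exact ⟨s, by simpa [ht] using hst⟩
  · refine exists_smul_sub_mem hU4 ?_ hf hfU hv
    rw [h.finrank_four_five.2] at hU5
    rw [h.finrank_four_five.1]
    omega

end InFamily

/-- Three vectors and a fourth one can be combined to a vector in the radical of `tri` on their
span. -/
theorem exists_radical_vector (S : SAA F L) (f g g' k : L) :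
    ∃ p, p ∈ Submodule.span F {f, g, g'} ∧ ∀ a b c d a' b' c' d' : F,
      S.tri (S.tri f g g' • k + p) (a • k + b • g' + c • g + d • f)
        (a' • k + b' • g' + c' • g + d' • f) = 0 := by
  -- The coefficients are the signed values of `tri` on the triples omitting one of the four
  -- vectors: an alternating 3-form in four dimensions is the contraction of a volume form with this
  -- vector.
  refine ⟨-S.tri f g k • g' + S.tri f g' k • g - S.tri g g' k • f, ?_, fun a b c d a' b' c' d' => ?_⟩
  · have hf : f ∈ Submodule.span F {f, g, g'} := Submodule.subset_span (by simp)
    have hg : g ∈ Submodule.span F {f, g, g'} := Submodule.subset_span (by simp)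
    have hg' : g' ∈ Submodule.span F {f, g, g'} := Submodule.subset_span (by simp)
    exact sub_mem (add_mem (Submodule.smul_mem _ _ hg') (Submodule.smul_mem _ _ hg))
      (Submodule.smul_mem _ _ hf)
  · have p1 : ∀ u v w, S.tri v w u = S.tri u v w := fun u v w => (S.tri_cycle u v w).symm
    have p2 : ∀ u v w, S.tri w u v = S.tri u v w := fun u v w => S.tri_cycle w u v
    have p3 : ∀ u v w, S.tri v u w = -S.tri u v w := fun u v w => S.tri_swap_left v u w
    have p4 : ∀ u v w, S.tri u w v = -S.tri u v w := fun u v w => S.tri_swap_right u w v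
    have p5 : ∀ u v w, S.tri w v u = -S.tri u v w := fun u v w => S.tri_swap_outer w v u
    simp only [tri_add_left, tri_add_mid, tri_add_right, tri_sub_left, tri_smul_left, tri_smul_mid,
      tri_smul_right, tri_self_left, tri_self_right, tri_self_outer,
      p1 f g g', p2 f g g', p3 f g g', p4 f g g', p5 f g g',
      p1 f g k, p2 f g k, p3 f g k, p4 f g k, p5 f g k,
      p1 f g' k, p2 f g' k, p3 f g' k, p4 f g' k, p5 f g' k,
      p1 g g' k, p2 g g' k, p3 g g' k, p4 g g' k, p5 g g' k]
    ring

/-- The vector y_3 comes from the radical of `tri` on j^⊥/U, and the x_i from repeated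
multiplication by a vector y with (j, y) = 1. The vectors f, g, g' descend through L^4, L^3, L^2 and
are dual to x_0, x_1, x_2 up to a triangular change. -/
theorem InFamily.exists_isChain (h : S.InFamily) : ∃ x y, S.IsChain S.idealU x y := by
  have := h.finiteDimensional
  obtain ⟨j, y, k, e, f, g, g', hj7, hJ, hjy, hjk, hk2, hkgen, heU, he5, hegen, hf, hfU, hfgen,
    hg, hg4, hg', hg'3⟩ := h.exists_frame
  have hβ := h.tri_ne_zero hf hfU hfgen hg hg4 hg' hg'3
  have h42 : S.power 4 ≤ S.power 2 := S.power_antitone (by norm_num)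
  have h32 : S.power 3 ≤ S.power 2 := S.power_antitone (by norm_num)
  have hU4 : S.idealU ≤ S.power 4 := fun u hu => (h.mem_idealU.1 hu).1
  have hj2 : ∀ p ∈ S.power 2, S.form j p = 0 := fun p hp =>
    h.form_power (by norm_num) (by norm_num) (by norm_num) hj7 hp
  have hU2 : ∀ u ∈ S.idealU, ∀ p ∈ S.power 2, ∃ c : F, S.mul u p = c • j := fun u hu p hp => by
    have := S.mul_mem_prod hu hp
    rw [h.prod_idealU_two, hJ] at this
    obtain ⟨c, hc⟩ := Submodule.mem_span_singleton.1 this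
    exact ⟨c, hc.symm⟩
  have hUp : ∀ u ∈ S.idealU, ∀ p ∈ S.power 2, ∀ v, S.form j v = 0 → S.tri u p v = 0 :=
    fun u hu p hp v hv => by
      obtain ⟨c, hc⟩ := hU2 u hu p hp
      rw [tri_def, hc, map_smul, LinearMap.smul_apply, hv, smul_zero]
  -- j^⊥ is L^2 together with k. Since UL^2 = Fj, the value is zero once an argument lies in L^2,
  -- and alternation handles the pair (k, k).
  have hUH : ∀ u ∈ S.idealU, ∀ v v', S.form j v = 0 → S.form j v' = 0 → S.tri u v v' = 0 := by
    intro u hu v v' hv hv'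
    obtain ⟨c, hc⟩ := hkgen v hv
    obtain ⟨d, hd⟩ := hkgen v' hv'
    have e1 := hUp u hu _ hc v' hv'
    have e2 := hUp u hu _ hd k hjk
    rw [tri_sub_mid, tri_smul_mid] at e1
    rw [tri_swap_right, tri_sub_right, tri_smul_right, tri_self_right, mul_zero, sub_zero,
      neg_eq_zero] at e2
    rwa [e2, mul_zero, sub_zero] at e1
  obtain ⟨p, hp, hrad⟩ := S.exists_radical_vector f g g' k
  have hp2 : p ∈ S.power 2 := by
    refine Submodule.span_le.2 ?_ hp
    rintro _ (rfl | rfl | rfl)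
    exacts [h42 hf, h32 hg, hg']
  set w := S.tri f g g' • k + p with hw
  have hjw : S.form j w = 0 := by simp [hw, hjk, hj2 p hp2]
  have hw2 : w ∉ S.power 2 := fun hm => hk2 (by
    rwa [hw, Submodule.add_mem_iff_left _ hp2, Submodule.smul_mem_iff _ hβ] at hm)
  have hyw : y ∉ S.power 2 ⊔ F ∙ w := by
    intro hm
    obtain ⟨q, hq, z, hz, rfl⟩ := Submodule.mem_sup.1 hm
    obtain ⟨c, rfl⟩ := Submodule.mem_span_singleton.1 hz
    simp [hj2 q hq, hjw] at hjy
  have hdecomp : ∀ v, S.form j v = 0 → ∃ a b c d : F, ∃ u ∈ S.idealU,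
      v = (a • k + b • g' + c • g + d • f) + u := by
    intro v hv
    obtain ⟨a, ha⟩ := hkgen v hv
    obtain ⟨b, hb⟩ := h.exists_smul_sub_mem_power (by norm_num)
      (by rw [h.finrank_two, h.finrank_three]) hg' hg'3 ha
    obtain ⟨c, hc⟩ := h.exists_smul_sub_mem_power (by norm_num)
      (by rw [h.finrank_four_five.1, h.finrank_three]) hg hg4 hb
    obtain ⟨d, hd⟩ := hfgen _ hc
    exact ⟨a, b, c, d, _, hd, by abel⟩
  have hwrad : ∀ v v', S.form j v = 0 → S.form j v' = 0 → S.tri w v v' = 0 := by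
    intro v v' hv hv'
    obtain ⟨a, b, c, d, u, hu, rfl⟩ := hdecomp v hv
    obtain ⟨a', b', c', d', u', hu', rfl⟩ := hdecomp v' hv'
    have hju := hj2 u (h42 (hU4 hu))
    rw [tri_add_mid, tri_add_right, hrad, ← tri_cycle S u', hUH u' hu' _ _ hjw (by
      simpa [hju] using hv), tri_swap_left, hUH u hu _ _ hjw hv']
    simp
  -- the action of `y` on `U`
  have hs1 : ∀ x ∈ S.idealU, x ∉ S.power 5 → S.form (S.mul y x) g ≠ 0 := by
    intro x hx hx5
    obtain ⟨c, hc⟩ := hU2 x hx g (h32 hg)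
    rw [← tri_def, tri_cycle, tri_def, hc, map_smul, LinearMap.smul_apply, hjy, smul_eq_mul,
      mul_one]
    rintro rfl
    exact h.mul_ne_zero_four_three (hU4 hx) hx5 hg hg4 (by rw [hc, zero_smul])
  have hs2 : ∀ x ∈ S.power 5, x ∉ S.power 6 → S.form (S.mul y x) g' ≠ 0 := by
    intro x hx hx6
    obtain ⟨c, hc⟩ := hU2 x (h.power_five_le_idealU hx) g' hg'
    rw [← tri_def, tri_cycle, tri_def, hc, map_smul, LinearMap.smul_apply, hjy, smul_eq_mul,
      mul_one]
    rintro rfl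
    exact h.mul_ne_zero_five_two hx hx6 hg' hg'3 (by rw [hc, zero_smul])
  -- Modulo L^2 the space L is spanned by w and y, so an x ∈ L^6 with (xw, y) = 0 is central by
  -- `mem_center_of_tri`.
  have hs3 : ∀ x ∈ S.power 6, x ∉ S.power 7 → S.form (S.mul y x) w ≠ 0 := by
    intro x hx hx7 h0
    rw [← tri_def, tri_cycle] at h0
    refine hx7 (h.mem_power_seven_iff.2 (mem_center_iff_tri.1 (h.mem_center_of_tri hw2 hyw
      (fun v hv => h.form_power (by norm_num) (by norm_num) (by norm_num) hx hv) h0)))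
  have hs4 : ∀ x ∈ S.power 7, S.mul y x = 0 := by
    intro x hx
    rw [S.mul_swap, mul_eq_zero_of_tri (h.mem_power_seven_iff.1 hx y), neg_zero]
  have hn5 : ∀ x ∈ S.power 5, S.form x g ≠ 0 → x ∉ S.power 6 := fun x _ hxg hx6 =>
    hxg (h.form_power (by norm_num) (by norm_num) (by norm_num) hx6 hg)
  have hn6 : ∀ x ∈ S.power 6, S.form x g' ≠ 0 → x ∉ S.power 7 := fun x _ hxg hx7 =>
    hxg (h.form_power (by norm_num) (by norm_num) (by norm_num) hx7 hg')
  -- the chain through an element of `U`, corrected to be orthogonal to `w`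
  obtain ⟨x₀, hx₀, hx₀5, hx₀y, hx₀w, hx₁w, hx₂w⟩ : ∃ x ∈ S.idealU, x ∉ S.power 5 ∧ S.form x y = 0 ∧
      S.form x w = 0 ∧ S.form (S.mul y x) w = 0 ∧ S.form (S.mul y (S.mul y x)) w = 0 := by
    have m1 := mul_mem_power_succ' (by norm_num) (hU4 heU) y
    have m2 := mul_mem_power_succ' (by norm_num) m1 y
    have m3 := mul_mem_power_succ' (by norm_num) m2 y
    have n1 := hn5 _ m1 (hs1 e heU he5)
    have n2 := hn6 _ m2 (hs2 _ m1 n1)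
    have n3 := hs3 _ m2 n2
    have z3 := hs4 _ m3
    have zj := hs4 j hj7
    set u₁ := S.mul y e with hu₁
    set u₂ := S.mul y u₁ with hu₂
    set u₃ := S.mul y u₂ with hu₃
    -- The corrected chain is e + a u₁ + b u₂ + c u₃ - (e, y) j, then u₁ + a u₂ + b u₃, then u₂ + a
    -- u₃. Orthogonality to w is a triangular system, solved from the last vector backwards; the j
    -- term makes the first vector orthogonal to y and is annihilated by y.
    set a := -S.form u₂ w / S.form u₃ w with ha
    set b := -(S.form u₁ w + a * S.form u₂ w) / S.form u₃ w with hb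
    set c := -(S.form e w + a * S.form u₁ w + b * S.form u₂ w) / S.form u₃ w with hc
    have ha' : a * S.form u₃ w = -S.form u₂ w := div_mul_cancel₀ _ n3
    have hb' : b * S.form u₃ w = -(S.form u₁ w + a * S.form u₂ w) := div_mul_cancel₀ _ n3
    have hc' : c * S.form u₃ w = -(S.form e w + a * S.form u₁ w + b * S.form u₂ w) :=
      div_mul_cancel₀ _ n3
    have hd : a • u₁ + b • u₂ + c • u₃ - S.form e y • j ∈ S.power 5 := by
      refine sub_mem (add_mem (add_mem ?_ ?_) ?_) ?_ <;> apply Submodule.smul_mem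
      · exact m1
      · exact S.power_antitone (by norm_num) m2
      · exact S.power_antitone (by norm_num) m3
      · exact S.power_antitone (by norm_num) hj7
    have v1 : S.form u₁ y = 0 := S.tri_self_outer y e
    have v2 : S.form u₂ y = 0 := S.tri_self_outer y u₁
    have v3 : S.form u₃ y = 0 := S.tri_self_outer y u₂
    have s1 : S.mul y (e + (a • u₁ + b • u₂ + c • u₃ - S.form e y • j)) =
        u₁ + a • u₂ + b • u₃ := by
      simp only [map_add, map_sub, map_smul, ← hu₁, ← hu₂, ← hu₃, z3, zj]
      simp [add_assoc]
    have s2 : S.mul y (u₁ + a • u₂ + b • u₃) = u₂ + a • u₃ := by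
      simp only [map_add, map_smul, ← hu₂, ← hu₃, z3]
      simp
    refine ⟨e + (a • u₁ + b • u₂ + c • u₃ - S.form e y • j),
      add_mem heU (h.power_five_le_idealU hd), ?_, ?_, ?_, ?_, ?_⟩
    · rwa [Submodule.add_mem_iff_left _ hd]
    · simp [v1, v2, v3, hjy]
    · simp [hjw, hc']
    · simp [s1, hb']
    · simp [s1, s2, ha']
  have m1 := mul_mem_power_succ' (by norm_num) (hU4 hx₀) y
  have m2 := mul_mem_power_succ' (by norm_num) m1 y
  have m3 := mul_mem_power_succ' (by norm_num) m2 y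
  have n1 := hs1 x₀ hx₀ hx₀5
  have n2 := hs2 _ m1 (hn5 _ m1 n1)
  have n3 := hs3 _ m2 (hn6 _ m2 n2)
  have z3 := hs4 _ m3
  have zj := hs4 j hj7
  have v1 : S.form (S.mul y x₀) y = 0 := S.tri_self_outer y _
  have v2 : S.form (S.mul y (S.mul y x₀)) y = 0 := S.tri_self_outer y _
  have v3 : S.form (S.mul y (S.mul y (S.mul y x₀))) y = 0 := S.tri_self_outer y _
  have n0 : S.form x₀ f ≠ 0 := by
    intro h0
    refine hx₀5 ((h.mem_power_iff (by norm_num) (by norm_num) (j := 4) rfl).2 fun v hv => ?_)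
    obtain ⟨c, hc⟩ := hfgen v hv
    have := h.idealU_isotropic _ hx₀ _ hc
    rwa [map_sub, map_smul, h0, smul_zero, sub_zero] at this
  set x₁ := S.mul y x₀ with hx₁
  set x₂ := S.mul y x₁ with hx₂
  set x₃ := S.mul y x₂ with hx₃
  have p (i j) (hi : 1 ≤ i) (hj : 1 ≤ j) (hij : 9 ≤ i + j) (u v) (hu : u ∈ S.power i)
    (hv : v ∈ S.power j) := h.form_power hi hj hij hu hv
  have f1 := p 5 4 (by norm_num) (by norm_num) (by norm_num) x₁ f m1 hf
  have f2 := p 6 4 (by norm_num) (by norm_num) (by norm_num) x₂ f m2 hf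
  have f3 := p 7 4 (by norm_num) (by norm_num) (by norm_num) x₃ f m3 hf
  have f4 := p 7 4 (by norm_num) (by norm_num) (by norm_num) j f hj7 hf
  have g2 := p 6 3 (by norm_num) (by norm_num) (by norm_num) x₂ g m2 hg
  have g3 := p 7 3 (by norm_num) (by norm_num) (by norm_num) x₃ g m3 hg
  have g4 := p 7 3 (by norm_num) (by norm_num) (by norm_num) j g hj7 hg
  have g'3 := p 7 2 (by norm_num) (by norm_num) (by norm_num) x₃ g' m3 hg'
  have g'4 := p 7 2 (by norm_num) (by norm_num) (by norm_num) j g' hj7 hg'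
  -- Gram–Schmidt: x₁, x₂, x₃ lie in L^5, L^6, L^7, so their pairings with f, g, g' are triangular.
  set y₀ := (S.form x₀ f)⁻¹ • f with hy₀
  set y₁ := (S.form x₁ g)⁻¹ • (g - S.form x₀ g • y₀) with hy₁
  set y₂ := (S.form x₂ g')⁻¹ • (g' - S.form x₀ g' • y₀ - S.form x₁ g' • y₁) with hy₂
  have hx : ∀ i, (![x₀, x₁, x₂, x₃, j] : Fin 5 → L) i ∈ S.idealU := by
    have h5 := h.power_five_le_idealU
    intro i
    fin_cases i
    exacts [hx₀, h5 m1, h5 (S.power_antitone (by norm_num) m2),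
      h5 (S.power_antitone (by norm_num) m3), h5 (S.power_antitone (by norm_num) hj7)]
  refine ⟨![x₀, x₁, x₂, x₃, j], ![y₀, y₁, y₂, (S.form x₃ w)⁻¹ • w, y],
    { mem := hx
      isotropic := h.idealU_isotropic
      dual := fun i l => ?_
      mul_self := fun u hu v hv => h.idealU_mul_idealU hu hv
      tri_left := hUH
      tri_three := fun v v' hv hv' => ?_
      mul_zero := rfl
      mul_one := rfl
      mul_two := rfl
      mul_three := z3
      mul_four := zj
      tri_ne := ?_ }⟩
  · have d0 : S.form x₀ y₀ = 1 := by simp [hy₀, n0]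
    have d1 : S.form x₁ y₀ = 0 := by simp [hy₀, f1]
    have d2 : S.form x₂ y₀ = 0 := by simp [hy₀, f2]
    have d3 : S.form x₃ y₀ = 0 := by simp [hy₀, f3]
    have d4 : S.form j y₀ = 0 := by simp [hy₀, f4]
    have e0 : S.form x₀ y₁ = 0 := by simp [hy₁, d0]
    have e1 : S.form x₁ y₁ = 1 := by simp [hy₁, d1, n1]
    have e2 : S.form x₂ y₁ = 0 := by simp [hy₁, d2, g2]
    have e3 : S.form x₃ y₁ = 0 := by simp [hy₁, d3, g3]
    have e4 : S.form j y₁ = 0 := by simp [hy₁, d4, g4]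
    fin_cases i <;> fin_cases l <;>
      simp [d0, d1, d2, d3, d4, e0, e1, e2, e3, e4, hy₂, n2, g'3, g'4, hx₀w, hx₁w, hx₂w, n3, hjw,
        hx₀y, v1, v2, v3, hjy]
  · change S.tri ((S.form x₃ w)⁻¹ • w) v v' = 0
    rw [tri_smul_left, hwrad v v' hv hv', mul_zero]
  · change S.tri y₀ y₁ y₂ ≠ 0
    have : S.tri y₀ y₁ y₂ =
        (S.form x₀ f)⁻¹ * (S.form x₁ g)⁻¹ * (S.form x₂ g')⁻¹ * S.tri f g g' := by
      simp only [hy₂, hy₁, hy₀, tri_smul_left, tri_smul_mid, tri_smul_right, tri_sub_mid,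
        tri_sub_right, tri_self_left, tri_self_right, tri_self_outer]
      ring
    rw [this]
    simp [n0, n1, n2, hβ]

end family

end SAA

theorem proposition3p5 {F : Type*} [Field F] :
    -- every algebra of the family has such a presentation
    (∀ (L : Type*) [AddCommGroup L] [Module F L] (S : SAA F L),
      S.InFamily → ∃ r : F, r ≠ 0 ∧ S.HasPresentation r) ∧
    -- every algebra with such a presentation belongs to the family
    (∀ (L : Type*) [AddCommGroup L] [Module F L] (S : SAA F L) (r : F),
      r ≠ 0 → S.HasPresentation r → S.InFamily) ∧
    -- every such presentation describes an algebra
    (∀ r : F, r ≠ 0 → ∃ S : SAA F (Fin 5 ⊕ Fin 5 → F), S.HasPresentation r) ∧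
    -- two such presentations describe the same algebra exactly when `s / r` is a cube
    (∀ (L M : Type*) [AddCommGroup L] [Module F L] [AddCommGroup M] [Module F M]
      (S : SAA F L) (T : SAA F M) (r s : F), r ≠ 0 → s ≠ 0 →
      S.HasPresentation r → T.HasPresentation s →
      (S.IsIsomorphic T ↔ ∃ a : F, a ≠ 0 ∧ s / r = a ^ 3)) := by
  refine ⟨fun L _ _ S h => ?_, fun L _ _ S r hr ⟨b, hb⟩ => SAA.inFamily_of_satisfies hr hb,
    fun r _ => ⟨SAA.model r, _, SAA.model_satisfies r⟩,
    fun L M _ _ _ _ S T r s hr hs ⟨b, hb⟩ ⟨b', hb'⟩ => ⟨?_, ?_⟩⟩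
  · obtain ⟨x, y, hxy⟩ := h.exists_isChain
    exact hxy.exists_presentation h.finrank_eq
  · rintro ⟨e, hform, hmul⟩
    exact (hb.map e hform hmul).exists_cube hr hs hb'
  · rintro ⟨a, ha, hsr⟩
    obtain rfl : s = r * a ^ 3 := by rw [← hsr, mul_div_cancel₀ _ hr]
    set u := Units.mk0 a ha with hu
    -- These weights multiply (x_1y_2, y_4) by u · u² = u³, while in the other three values the
    -- factors cancel.
    refine SAA.Satisfies.isIsomorphic ((hb.scale ![u, u, (u ^ 2)⁻¹, (u ^ 2)⁻¹, 1]).congr ?_ ?_) hb'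
    · intro i j k hij hjk
      fin_cases j <;> fin_cases k <;> simp at hjk <;> fin_cases i <;> simp at hij <;>
        simp [SAA.alphaP, hu, ha]
      ring
    · intro i j k hij hjk
      fin_cases j <;> fin_cases k <;> simp at hjk <;> fin_cases i <;> simp at hij <;>
        simp [SAA.betaP, hu]
      field_simp
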